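/- Let $n\ge 1$, $s\in(0,1)$, and let $\mathcal O\subset\mathbb R^n$ be a bounded domain (open, connected, non-empty) with Lipschitz boundary. Let $H^s(\mathbb R^n)=W^{s,2}(\mathbb R^n)$ be the space of real functions $u\in L^2(\mathbb R^n)$ with $\iint\frac{|u(x)-u(y)|^2}{|x-y|^{n+2s}}\,dx\,dy<\infty$, with its usual Hilbert norm. For $A\subset\mathbb R^n$ let $\widetilde H^s(A)=\{v\in H^s(\mathbb R^n): v=0 \text{ a.e. in } \mathbb R^n\setminus A\}$, and put $$\mathcal B^s(u,v)=\frac{c_{n,s}}{2}\iint\frac{(u(x)-u(y))(v(x)-v(y))}{|x-y|^{n+2s}}\,dx\,dy,\qquad c_{n,s}=\frac{\Gamma(\frac n2+s)}{|\Gamma(-s)|}\,\frac{4^s}{\pi^{n/2}}.$$ For $A\subset\mathcal O$, $f\in\widetilde H^s(\mathcal O)^*$ and $g\in H^s(\mathbb R^n)$, a solution of $$(-\Delta)^s u=f\ \text{ in } A,\qquad u=g\ \text{ in }\mathbb R^n\setminus A$$ is a $u\in H^s(\mathbb R^n)$ with $u-g\in\widetilde H^s(A)$ and $\mathcal B^s(u,w)=\langle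 f,w\rangle$ for all $w\in\widetilde H^s(A)$. Let $\{T_\varepsilon\}_{\varepsilon>0}$ be closed subsets of $\mathbb R^n$ (the holes), and let the perforated domains $\mathcal O_\varepsilon=\mathcal O\setminus\bigcup_{0<\delta\le\varepsilon}T_\delta$ satisfy $\lim_{\varepsilon\to0}|\mathcal O\setminus\mathcal O_\varepsilon|=0$ (Lebesgue outer measure). Assume that there are functions $w_\varepsilon$, $\varepsilon>0$, such that (H1) $w_\varepsilon\in H^1(\mathcal O)$; (H2) $w_\varepsilon=0$ a.e. on $\mathcal O\cap\bigcup_{0<\delta\le\varepsilon}T_\delta$; (H3) $w_\varepsilon\rightharpoonup1$ weakly in $H^1(\mathcal O)$ as $\varepsilon\to0$. Let $f\in\widetilde H^s(\mathcal O)^*$ and $g\in H^s(\mathbb R^n)$, and for each $\varepsilon>0$ let $u_\varepsilon\in H^s(\mathbb R^n)$ be the solution of $$(-\Delta)^su_\varepsilon=f\ \text{ in }\mathcal O_\varepsilon,\qquad u_\varepsilon=g\ \text{ in }\mathbb R^n\setminus\mathcal O_\varepsilon.$$ Then the problem $$(-\Delta)^su=f\ \text{ in }\mathcal O,\qquad u=g\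 \text{ in }\mathbb R^n\setminus\mathcal O$$ has a unique solution $u\in H^s(\mathbb R^n)$, and, as $\varepsilon\to0$, up to a subsequence, $u_\varepsilon\rightharpoonup u$ weakly in $H^s(\mathbb R^n)$; that is, every sequence $\varepsilon_k\to0$ of positive numbers has a subsequence along which $u_{\varepsilon_k}\rightharpoonup u$ weakly in $H^s(\mathbb R^n)$. -/

import Mathlib

open MeasureTheory Filter Topology Set
open scoped NNReal ENNReal ContDiff

noncomputable section

namespace FracHom

/-- The Euclidean space `ℝⁿ`. -/
abbrev Space (n : ℕ) : Type := EuclideanSpace ℝ (Fin n)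

/-- A bounded domain with Lipschitz boundary: around every boundary point there are a direction
`ν` and a Lipschitz function `γ` of the component orthogonal to `ν`, such that locally the domain
is the region strictly above the graph of `γ` in the direction `ν`. -/
structure IsBoundedLipschitzDomain {n : ℕ} (O : Set (Space n)) : Prop where
  isOpen : IsOpen O
  isConnected : IsConnected O
  isBounded : Bornology.IsBounded O
  lipschitz_boundary : ∀ x₀ ∈ frontier O, ∃ ν : Space n, ‖ν‖ = 1 ∧ ∃ r : ℝ, 0 < r ∧
    ∃ (K : ℝ≥0) (γ : Space n → ℝ), LipschitzWith K γ ∧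
      ∀ y ∈ Metric.ball x₀ r, y ∈ O ↔ γ (y - inner ℝ ν y • ν) < inner ℝ ν y

/-! ### The space `H¹(O)` -/

/-- `G` is the weak gradient of `u` on the open set `O`. -/
def IsWeakGradient {n : ℕ} (O : Set (Space n)) (u : Space n → ℝ) (G : Space n → Space n) : Prop :=
  ∀ φ : Space n → ℝ, ContDiff ℝ ∞ φ → HasCompactSupport φ → tsupport φ ⊆ O →
    ∀ v : Space n, ∫ x in O, u x * fderiv ℝ φ x v = -∫ x in O, inner ℝ (G x) v * φ x

theorem integrable_mul_of_test {n : ℕ} {μ : Measure (Space n)} [IsFiniteMeasureOnCompacts μ]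
    (u : Lp ℝ 2 μ) {ψ : Space n → ℝ} (hψ : Continuous ψ) (hc : HasCompactSupport ψ) :
    Integrable (fun x => u x * ψ x) μ :=
  MemLp.integrable_mul (q := 2) (Lp.memLp u) (hψ.memLp_of_hasCompactSupport hc)

theorem integrable_inner_mul_of_test {n : ℕ} {μ : Measure (Space n)}
    [IsFiniteMeasureOnCompacts μ] (G : Lp (Space n) 2 μ) (v : Space n) {ψ : Space n → ℝ}
    (hψ : Continuous ψ) (hc : HasCompactSupport ψ) :
    Integrable (fun x => inner ℝ (G x) v * ψ x) μ :=
  MemLp.integrable_mul (q := 2) ((Lp.memLp G).inner_const v) (hψ.memLp_of_hasCompactSupport hc)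

theorem test_fderiv {n : ℕ} {φ : Space n → ℝ} (hφ : ContDiff ℝ ∞ φ) (hc : HasCompactSupport φ)
    (v : Space n) : Continuous (fun x => fderiv ℝ φ x v) ∧
      HasCompactSupport (fun x => fderiv ℝ φ x v) :=
  ⟨(hφ.continuous_fderiv (by simp)).clm_apply continuous_const, hc.fderiv_apply ℝ v⟩

theorem integral_test_fderiv {n : ℕ} {φ : Space n → ℝ} (hφ : ContDiff ℝ ∞ φ)
    (hc : HasCompactSupport φ) (v : Space n) : ∫ x, fderiv ℝ φ x v = 0 := by
  obtain ⟨hd, hdc⟩ := test_fderiv hφ hc v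
  have h := integral_mul_fderiv_eq_neg_fderiv_mul_of_integrable (μ := (volume : Measure (Space n)))
    (f := fun _ => (1 : ℝ)) (g := φ) (v := v) (by simp)
    (by simpa using hd.integrable_of_hasCompactSupport hdc)
    (by simpa using hφ.continuous.integrable_of_hasCompactSupport hc)
    (fun x _ => differentiableAt_const _) (fun x _ => hφ.differentiable (by simp) x)
  simpa using h

theorem integral_zero_inner {n : ℕ} {μ : Measure (Space n)} (φ : Space n → ℝ) (v : Space n) :
    ∫ x, inner ℝ ((0 : Lp (Space n) 2 μ) x) v * φ x ∂μ = 0 := by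
  refine integral_eq_zero_of_ae ?_
  filter_upwards [Lp.coeFn_zero (Space n) 2 μ] with x hx
  rw [hx]
  simp

/-- The Hilbert space `H¹(O)`, realised as the pairs `(u, ∇u)` in `L²(O) × L²(O; ℝⁿ)` where `∇u`
is the weak gradient of `u`; the norm is `‖u‖² + ‖∇u‖²`. -/
def H1 {n : ℕ} (O : Set (Space n)) : Submodule ℝ
    (WithLp 2 (Lp ℝ 2 (volume.restrict O) × Lp (Space n) 2 (volume.restrict O))) where
  carrier := {p | IsWeakGradient O p.fst p.snd}
  zero_mem' := by
    intro φ hφ hc hsupp v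
    have h1 : ∫ x in O, (0 : Lp ℝ 2 (volume.restrict O)) x * fderiv ℝ φ x v = 0 := by
      refine integral_eq_zero_of_ae ?_
      filter_upwards [Lp.coeFn_zero ℝ 2 (volume.restrict O)] with x hx
      rw [hx]
      simp
    exact h1.trans (by rw [WithLp.zero_snd, integral_zero_inner, neg_zero])
  add_mem' := by
    intro p q hp hq φ hφ hc hsupp v
    obtain ⟨hd, hdc⟩ := test_fderiv hφ hc v
    have h1 : ∫ x in O, (p.fst + q.fst : Lp ℝ 2 (volume.restrict O)) x * fderiv ℝ φ x v =
        (∫ x in O, p.fst x * fderiv ℝ φ x v) + ∫ x in O, q.fst x * fderiv ℝ φ x v := by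
      rw [← integral_add (integrable_mul_of_test _ hd hdc) (integrable_mul_of_test _ hd hdc)]
      refine integral_congr_ae ?_
      filter_upwards [Lp.coeFn_add p.fst q.fst] with x hx
      simp only [hx, Pi.add_apply]
      ring
    have h2 : ∫ x in O, inner ℝ ((p.snd + q.snd : Lp (Space n) 2 (volume.restrict O)) x) v * φ x =
        (∫ x in O, inner ℝ (p.snd x) v * φ x) + ∫ x in O, inner ℝ (q.snd x) v * φ x := by
      rw [← integral_add (integrable_inner_mul_of_test _ v hφ.continuous hc)
        (integrable_inner_mul_of_test _ v hφ.continuous hc)]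
      refine integral_congr_ae ?_
      filter_upwards [Lp.coeFn_add p.snd q.snd] with x hx
      simp only [hx, Pi.add_apply, inner_add_left]
      ring
    have hp' := hp φ hφ hc hsupp v
    have hq' := hq φ hφ hc hsupp v
    simp only [WithLp.add_fst, WithLp.add_snd]
    rw [h1, h2, hp', hq']
    ring
  smul_mem' := by
    intro c p hp φ hφ hc hsupp v
    have h1 : ∫ x in O, (c • p.fst : Lp ℝ 2 (volume.restrict O)) x * fderiv ℝ φ x v =
        c * ∫ x in O, p.fst x * fderiv ℝ φ x v := by
      rw [← integral_const_mul]
      refine integral_congr_ae ?_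
      filter_upwards [Lp.coeFn_smul c p.fst] with x hx
      simp only [hx, Pi.smul_apply, smul_eq_mul]
      ring
    have h2 : ∫ x in O, inner ℝ ((c • p.snd : Lp (Space n) 2 (volume.restrict O)) x) v * φ x =
        c * ∫ x in O, inner ℝ (p.snd x) v * φ x := by
      rw [← integral_const_mul]
      refine integral_congr_ae ?_
      filter_upwards [Lp.coeFn_smul c p.snd] with x hx
      simp only [hx, Pi.smul_apply, real_inner_smul_left]
      ring
    have hp' := hp φ hφ hc hsupp v
    simp only [WithLp.smul_fst, WithLp.smul_snd]
    rw [h1, h2, hp']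
    ring

/-- The function (class) underlying an element of `H¹(O)`. -/
def H1fn {n : ℕ} {O : Set (Space n)} (w : H1 O) : Lp ℝ 2 (volume.restrict O) := w.1.fst

/-- The constant function `1` in `L²(O)`, for bounded `O`. -/
def oneL2 {n : ℕ} {O : Set (Space n)} (hO : Bornology.IsBounded O) :
    Lp ℝ 2 (volume.restrict O) :=
  indicatorConstLp 2 MeasurableSet.univ
    (by rw [Measure.restrict_apply_univ]; exact hO.measure_lt_top.ne) (1 : ℝ)

theorem oneL2_ae {n : ℕ} {O : Set (Space n)} (hO : Bornology.IsBounded O) :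
    ∀ᵐ x ∂(volume.restrict O), oneL2 hO x = 1 := by
  filter_upwards [indicatorConstLp_coeFn (p := 2) (hs := MeasurableSet.univ)
    (hμs := by rw [Measure.restrict_apply_univ]; exact hO.measure_lt_top.ne) (c := (1 : ℝ))
    (μ := volume.restrict O)] with x hx
  rw [oneL2, hx]
  simp

/-- The constant function `1` (with gradient `0`) as an element of `H¹(O)`, for bounded `O`. -/
def H1.one {n : ℕ} {O : Set (Space n)} (hO : Bornology.IsBounded O) : H1 O :=
  ⟨WithLp.toLp 2 (oneL2 hO, 0), by
    intro φ hφ hc hsupp v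
    have h1 : ∫ x in O, oneL2 hO x * fderiv ℝ φ x v = 0 := by
      have e1 : ∫ x in O, oneL2 hO x * fderiv ℝ φ x v = ∫ x in O, fderiv ℝ φ x v := by
        refine integral_congr_ae ?_
        filter_upwards [oneL2_ae hO] with x hx
        simp [hx]
      have e2 : ∫ x in O, fderiv ℝ φ x v = ∫ x, fderiv ℝ φ x v := by
        refine setIntegral_eq_integral_of_forall_compl_eq_zero fun x hx => ?_
        have : x ∉ tsupport φ := fun h => hx (hsupp h)
        have h0 : fderiv ℝ φ x = 0 := by
          by_contra hne
          exact this (support_fderiv_subset ℝ hne)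
        simp [h0]
      rw [e1, e2, integral_test_fderiv hφ hc v]
    exact h1.trans (by exact (by rw [integral_zero_inner, neg_zero] : (0 : ℝ) =
      -∫ x in O, inner ℝ ((0 : Lp (Space n) 2 (volume.restrict O)) x) v * φ x))⟩

/-! ### The space `Hˢ(ℝⁿ)` and the fractional Laplacian -/

/-- The difference quotient `(u(x) - u(y)) / |x - y|^{n/2 + s}`, whose `L²(ℝⁿ × ℝⁿ)` norm is the
Gagliardo seminorm of `u`. -/
def diffQuot {n : ℕ} (s : ℝ) (u : Space n → ℝ) (z : Space n × Space n) : ℝ :=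
  (u z.1 - u z.2) / ‖z.1 - z.2‖ ^ ((n : ℝ) / 2 + s)

theorem ae_prod_of_ae {n : ℕ} {P : Space n → Prop} (h : ∀ᵐ x, P x) :
    ∀ᵐ z : Space n × Space n, P z.1 ∧ P z.2 :=
  (Measure.quasiMeasurePreserving_fst.ae h).and (Measure.quasiMeasurePreserving_snd.ae h)

/-- The Hilbert space `Hˢ(ℝⁿ) = W^{s,2}(ℝⁿ)` of real functions, `0 < s < 1`: the functions
`u ∈ L²(ℝⁿ)` whose difference quotient lies in `L²(ℝⁿ × ℝⁿ)`, realised as the pairs of `u` and its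
difference quotient; the norm is `‖u‖² + ∬ |u(x) - u(y)|² / |x - y|^{n + 2s}`. -/
def Hs (n : ℕ) (s : ℝ) : Submodule ℝ
    (WithLp 2 (Lp ℝ 2 (volume : Measure (Space n)) ×
      Lp ℝ 2 (volume : Measure (Space n × Space n)))) where
  carrier := {p | p.snd =ᵐ[volume] diffQuot s p.fst}
  zero_mem' := by
    change ((0 : Lp ℝ 2 (volume : Measure (Space n × Space n))) : Space n × Space n → ℝ) =ᵐ[volume]
      diffQuot s (0 : Lp ℝ 2 (volume : Measure (Space n)))
    filter_upwards [Lp.coeFn_zero ℝ 2 (volume : Measure (Space n × Space n)),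
      ae_prod_of_ae (Lp.coeFn_zero ℝ 2 (volume : Measure (Space n)))] with z h h'
    simp only [diffQuot]
    rw [h, h'.1, h'.2]
    simp
  add_mem' := by
    intro p q hp hq
    change ((p.snd + q.snd : Lp ℝ 2 (volume : Measure (Space n × Space n))) :
      Space n × Space n → ℝ) =ᵐ[volume]
      diffQuot s (p.fst + q.fst : Lp ℝ 2 (volume : Measure (Space n)))
    filter_upwards [hp, hq, Lp.coeFn_add p.snd q.snd,
      ae_prod_of_ae (Lp.coeFn_add p.fst q.fst)] with z h1 h2 h h'
    simp only [h, Pi.add_apply, h1, h2, diffQuot, h'.1, h'.2]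
    ring
  smul_mem' := by
    intro c p hp
    change ((c • p.snd : Lp ℝ 2 (volume : Measure (Space n × Space n))) :
      Space n × Space n → ℝ) =ᵐ[volume]
      diffQuot s (c • p.fst : Lp ℝ 2 (volume : Measure (Space n)))
    filter_upwards [hp, Lp.coeFn_smul c p.snd,
      ae_prod_of_ae (Lp.coeFn_smul c p.fst)] with z h1 h h'
    simp only [h, Pi.smul_apply, smul_eq_mul, h1, diffQuot, h'.1, h'.2]
    ring

/-- The function (class) underlying an element of `Hˢ(ℝⁿ)`. -/
def Hsfn {n : ℕ} {s : ℝ} (u : Hs n s) : Lp ℝ 2 (volume : Measure (Space n)) := u.1.fst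

/-- The normalising constant of
`(-Δ)ˢ u(x) = c_{n,s} P.V. ∫ (u(x) - u(y)) / |x - y|^{n + 2s} dy`. -/
def fracConst (n : ℕ) (s : ℝ) : ℝ :=
  Real.Gamma ((n : ℝ) / 2 + s) / |Real.Gamma (-s)| * (4 ^ s / Real.pi ^ ((n : ℝ) / 2))

/-- The bilinear form of the fractional Laplacian on `Hˢ(ℝⁿ)`,
`B(u, v) = ⟨(-Δ)ˢ u, v⟩ = ∫ (-Δ)^{s/2} u (-Δ)^{s/2} v`. -/
def fracForm {n : ℕ} {s : ℝ} (u v : Hs n s) : ℝ :=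
  fracConst n s / 2 * ∫ z : Space n × Space n,
    (Hsfn u z.1 - Hsfn u z.2) * (Hsfn v z.1 - Hsfn v z.2) / ‖z.1 - z.2‖ ^ ((n : ℝ) + 2 * s)

/-- The space of the `v ∈ Hˢ(ℝⁿ)` that vanish a.e. outside `A`. -/
def HsTilde {n : ℕ} (s : ℝ) (A : Set (Space n)) : Submodule ℝ (Hs n s) where
  carrier := {v | ∀ᵐ x, x ∉ A → Hsfn v x = 0}
  zero_mem' := by
    change ∀ᵐ x, x ∉ A → (0 : Lp ℝ 2 (volume : Measure (Space n))) x = 0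
    filter_upwards [Lp.coeFn_zero ℝ 2 (volume : Measure (Space n))] with x hx _
    rw [hx]
    rfl
  add_mem' := by
    intro u v hu hv
    change ∀ᵐ x, x ∉ A → (Hsfn u + Hsfn v : Lp ℝ 2 (volume : Measure (Space n))) x = 0
    filter_upwards [hu, hv, Lp.coeFn_add (Hsfn u) (Hsfn v)] with x h1 h2 h hx
    rw [h, Pi.add_apply, h1 hx, h2 hx, add_zero]
  smul_mem' := by
    intro c u hu
    change ∀ᵐ x, x ∉ A → (c • Hsfn u : Lp ℝ 2 (volume : Measure (Space n))) x = 0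
    filter_upwards [hu, Lp.coeFn_smul c (Hsfn u)] with x h1 h hx
    rw [h, Pi.smul_apply, h1 hx, smul_zero]

/-- `u ∈ Hˢ(ℝⁿ)` is the (weak) solution of `(-Δ)ˢ u = f` in `A`, `u = g` in `ℝⁿ \ A`, where
`A ⊆ O` and `f` is a bounded linear functional on `HsTilde s O`: `u - g` vanishes outside `A`, and
`B(u, w) = ⟨f, w⟩` for all `w` that vanish outside `A`. -/
def IsWeakSolution {n : ℕ} {s : ℝ} {O : Set (Space n)} (f : HsTilde s O →L[ℝ] ℝ) (g : Hs n s)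
    (A : Set (Space n)) (u : Hs n s) : Prop :=
  u - g ∈ HsTilde s A ∧
    ∀ w : HsTilde s O, (w : Hs n s) ∈ HsTilde s A → fracForm u (w : Hs n s) = f w

/-! ### Perforated domains -/

/-- The union of the holes `T_δ` with `0 < δ ≤ ε`. -/
def holes {n : ℕ} (T : ℝ → Set (Space n)) (ε : ℝ) : Set (Space n) :=
  ⋃ δ ∈ Ioc 0 ε, T δ

/-- The perforated domain `O_ε = O \ ⋃_{0 < δ ≤ ε} T_δ`. -/
def perforated {n : ℕ} (O : Set (Space n)) (T : ℝ → Set (Space n)) (ε : ℝ) : Set (Space n) :=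
  O \ holes T ε

/-- Weak convergence in a real normed space. -/
def WeaklyTendsto {ι H : Type*} [NormedAddCommGroup H] [NormedSpace ℝ H] (u : ι → H)
    (l : Filter ι) (a : H) : Prop :=
  Tendsto (fun i => toWeakSpace ℝ H (u i)) l (𝓝 (toWeakSpace ℝ H a))

end FracHom

end

open scoped Convolution

namespace FracHom

/-! ### The Hilbert space `Hs`, its closed subspaces `HsTilde`, and coercivity of the energy. -/

section Basic

/-! ### Square integrable functions -/

/-! The problem in a perforated domain is a Galerkin approximation of the problem in `O`. The same
form and the same data are tested only on the subspace `HsTilde s (perforated O T ε)`. The form is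
coercive on `HsTilde s O` by a fractional Poincaré inequality, so Céa's lemma (`exists_norm_sub_le`)
bounds `‖u ε - u₀‖` by a constant times the distance from `u₀ - g` to that subspace. Since the holes
accumulate as `ε` grows, the subspaces increase as `ε` decreases to 0. It therefore suffices that
their union is dense in `HsTilde s O`, and the convergence is then strong and holds for the whole
family.

Density has two ingredients. For a test function `φ` in `O`, multiplication by `φ` followed by
extension by zero is bounded from `H1 O` to `Hs n s` (`exists_cutoff_operator`). Hence the products
`φ w_ε`, which vanish on the holes, converge weakly to `φ`, and a closed subspace is weakly closed
(`mem_perforatedClosure_of_test`). Test functions are in turn dense in `HsTilde s O` because the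
boundary is Lipschitz (`HsTilde_le_of_containsTest`): localise by a partition of unity, push each
piece into `O` and mollify.

Mollifications are only shown to be bounded in `Hs` and convergent in L². By
`mem_of_tendsto_of_bounded` this is enough for the limit to lie in a closed subspace. -/

theorem eLpNorm_two_sq {α E : Type*} [MeasurableSpace α] {μ : Measure α} [NormedAddCommGroup E]
    (f : α → E) : eLpNorm f 2 μ ^ 2 = ∫⁻ x, ‖f x‖ₑ ^ 2 ∂μ := by
  rw [eLpNorm_eq_lintegral_rpow_enorm_toReal (by simp) (by simp), ← ENNReal.rpow_natCast,
    ← ENNReal.rpow_mul]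
  simp

theorem enorm_sq_eq_lintegral {α E : Type*} [MeasurableSpace α] {μ : Measure α}
    [NormedAddCommGroup E] (F : Lp E 2 μ) : ‖F‖ₑ ^ 2 = ∫⁻ x, ‖F x‖ₑ ^ 2 ∂μ := by
  rw [← eLpNorm_two_sq, Lp.enorm_def]

theorem memLp_two_of_lintegral_lt_top {α E : Type*} [MeasurableSpace α] {μ : Measure α}
    [NormedAddCommGroup E] {f : α → E} (hf : AEStronglyMeasurable f μ)
    (h : ∫⁻ x, ‖f x‖ₑ ^ 2 ∂μ < ⊤) : MemLp f 2 μ := by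
  refine ⟨hf, ?_⟩
  rw [← eLpNorm_two_sq] at h
  exact (ENNReal.pow_lt_top_iff.1 h).resolve_right two_ne_zero

theorem exists_subseq_tendsto_ae {α E : Type*} [MeasurableSpace α] {μ : Measure α}
    [NormedAddCommGroup E] {F : ℕ → Lp E 2 μ} {f : Lp E 2 μ} (h : Tendsto F atTop (𝓝 f)) :
    ∃ φ : ℕ → ℕ, StrictMono φ ∧ ∀ᵐ x ∂μ, Tendsto (fun k => F (φ k) x) atTop (𝓝 (f x)) :=
  (tendstoInMeasure_of_tendsto_Lp h).exists_seq_tendsto_ae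

/-! ### `Hˢ(ℝⁿ)` as a Hilbert space -/

variable {n : ℕ} {s : ℝ}

/-- Convergence of both components gives a common subsequence converging a.e., along which the
pointwise relation between function and quotient survives. -/
theorem isClosed_Hs : IsClosed (Hs n s : Set (WithLp 2 (Lp ℝ 2 (volume : Measure (Space n)) ×
      Lp ℝ 2 (volume : Measure (Space n × Space n))))) := by
  refine IsSeqClosed.isClosed fun x p hx hp => ?_
  have h1 : Tendsto (fun k => (x k).fst) atTop (𝓝 p.fst) :=
    ((WithLp.continuous_fst 2 _ _).tendsto p).comp hp
  have h2 : Tendsto (fun k => (x k).snd) atTop (𝓝 p.snd) :=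
    ((WithLp.continuous_snd 2 _ _).tendsto p).comp hp
  obtain ⟨φ, hφ, h3⟩ := exists_subseq_tendsto_ae h1
  obtain ⟨ψ, hψ, h4⟩ := exists_subseq_tendsto_ae (h2.comp hφ.tendsto_atTop)
  have h5 : ∀ᵐ z : Space n × Space n, ∀ k, (x k).snd z = diffQuot s (x k).fst z :=
    ae_all_iff.2 hx
  change p.snd =ᵐ[volume] diffQuot s p.fst
  filter_upwards [ae_prod_of_ae h3, h4, h5] with z hz1 hz2 hz3
  refine tendsto_nhds_unique hz2 ?_
  simp only [Function.comp_def, hz3, diffQuot]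
  exact ((hz1.1.comp hψ.tendsto_atTop).sub (hz1.2.comp hψ.tendsto_atTop)).div_const _

instance : CompleteSpace (Hs n s) := isClosed_Hs.completeSpace_coe

/-- The inclusion `Hˢ(ℝⁿ) → L²(ℝⁿ)`. -/
noncomputable def HsfnL : Hs n s →L[ℝ] Lp ℝ 2 (volume : Measure (Space n)) :=
  (WithLp.fstL 2 ℝ _ _).comp (Hs n s).subtypeL

/-- The difference quotient as a map `Hˢ(ℝⁿ) → L²(ℝⁿ × ℝⁿ)`. -/
noncomputable def HsquotL : Hs n s →L[ℝ] Lp ℝ 2 (volume : Measure (Space n × Space n)) :=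
  (WithLp.sndL 2 ℝ _ _).comp (Hs n s).subtypeL

theorem HsfnL_apply (u : Hs n s) : HsfnL u = Hsfn u := rfl

theorem HsquotL_ae (u : Hs n s) : HsquotL u =ᵐ[volume] diffQuot s (Hsfn u) := u.2

theorem Hs_norm_sq (u : Hs n s) : ‖u‖ ^ 2 = ‖Hsfn u‖ ^ 2 + ‖HsquotL u‖ ^ 2 :=
  WithLp.prod_norm_sq_eq_of_L2 u.1

theorem Hs_ext {u v : Hs n s} (h : Hsfn u = Hsfn v) : u = v := by
  have h2 : HsquotL u = HsquotL v := by
    refine Lp.ext ?_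
    filter_upwards [HsquotL_ae u, HsquotL_ae v] with z h1 h2
    rw [h1, h2, h]
  refine Subtype.ext ((WithLp.equiv 2 _).injective (Prod.ext h h2))

theorem HsfnL_injective : Function.Injective (HsfnL : Hs n s →L[ℝ] _) := fun _ _ h => Hs_ext h

theorem measurable_diffQuot {v : Space n → ℝ} (hv : AEStronglyMeasurable v volume) :
    AEStronglyMeasurable (diffQuot s v) volume := by
  refine AEStronglyMeasurable.div₀ ?_ ?_
  · exact (hv.comp_quasiMeasurePreserving Measure.quasiMeasurePreserving_fst).sub
      (hv.comp_quasiMeasurePreserving Measure.quasiMeasurePreserving_snd)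
  · have : Measurable fun z : Space n × Space n => ‖z.1 - z.2‖ ^ ((n : ℝ) / 2 + s) :=
      ((measurable_fst.sub measurable_snd).norm).pow_const _
    exact this.aestronglyMeasurable

theorem diffQuot_congr {u v : Space n → ℝ} (h : u =ᵐ[volume] v) :
    diffQuot s u =ᵐ[volume] diffQuot s v := by
  filter_upwards [ae_prod_of_ae h] with z hz
  simp only [diffQuot, hz.1, hz.2]

/-- A square integrable function with finite Gagliardo seminorm defines an element of `Hˢ(ℝⁿ)`. -/
theorem exists_Hs_of_memLp {v : Space n → ℝ} (hv : MemLp v 2) (hq : MemLp (diffQuot s v) 2) :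
    ∃ u : Hs n s, Hsfn u =ᵐ[volume] v := by
  refine ⟨⟨WithLp.toLp 2 (hv.toLp v, hq.toLp _), ?_⟩, hv.coeFn_toLp⟩
  exact hq.coeFn_toLp.trans (diffQuot_congr hv.coeFn_toLp.symm)

theorem Hs_norm_le {u : Hs n s} {v : Space n → ℝ} (h : Hsfn u =ᵐ[volume] v) {a b : ℝ}
    (ha : 0 ≤ a) (hb : 0 ≤ b) (h1 : ∫⁻ x, ‖v x‖ₑ ^ 2 ≤ ENNReal.ofReal (a ^ 2))
    (h2 : ∫⁻ z, ‖diffQuot s v z‖ₑ ^ 2 ≤ ENNReal.ofReal (b ^ 2)) : ‖u‖ ≤ a + b := by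
  have e1 : ‖Hsfn u‖ ^ 2 ≤ a ^ 2 := by
    rw [← ENNReal.ofReal_le_ofReal_iff (by positivity), ENNReal.ofReal_pow (norm_nonneg _),
      ofReal_norm, enorm_sq_eq_lintegral]
    refine le_of_eq_of_le (lintegral_congr_ae ?_) h1
    filter_upwards [h] with x hx
    rw [hx]
  have e2 : ‖HsquotL u‖ ^ 2 ≤ b ^ 2 := by
    rw [← ENNReal.ofReal_le_ofReal_iff (by positivity), ENNReal.ofReal_pow (norm_nonneg _),
      ofReal_norm, enorm_sq_eq_lintegral]
    refine le_of_eq_of_le (lintegral_congr_ae ?_) h2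
    filter_upwards [HsquotL_ae u, diffQuot_congr (s := s) h] with x hx hx'
    rw [hx, hx']
  have := Hs_norm_sq u
  refine abs_le_of_sq_le_sq' ?_ (by positivity) |>.2
  nlinarith [mul_nonneg ha hb]

theorem Hsfn_lintegral_le (u : Hs n s) : ∫⁻ x, ‖Hsfn u x‖ₑ ^ 2 ≤ ENNReal.ofReal (‖u‖ ^ 2) := by
  rw [← enorm_sq_eq_lintegral, ← ofReal_norm, ← ENNReal.ofReal_pow (norm_nonneg _)]
  refine ENNReal.ofReal_le_ofReal ?_
  rw [Hs_norm_sq]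
  nlinarith [sq_nonneg ‖HsquotL u‖]

theorem diffQuot_lintegral_le (u : Hs n s) :
    ∫⁻ z, ‖diffQuot s (Hsfn u) z‖ₑ ^ 2 ≤ ENNReal.ofReal (‖u‖ ^ 2) := by
  have : ∫⁻ z, ‖diffQuot s (Hsfn u) z‖ₑ ^ 2 = ‖HsquotL u‖ₑ ^ 2 := by
    rw [enorm_sq_eq_lintegral]
    refine lintegral_congr_ae ?_
    filter_upwards [HsquotL_ae u] with x hx
    rw [hx]
  rw [this, ← ofReal_norm, ← ENNReal.ofReal_pow (norm_nonneg _)]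
  refine ENNReal.ofReal_le_ofReal ?_
  rw [Hs_norm_sq]
  nlinarith [sq_nonneg ‖Hsfn u‖]

theorem isClosed_HsTilde (A : Set (Space n)) : IsClosed (HsTilde s A : Set (Hs n s)) := by
  refine IsSeqClosed.isClosed fun x p hx hp => ?_
  obtain ⟨φ, hφ, h3⟩ := exists_subseq_tendsto_ae ((HsfnL.continuous.tendsto p).comp hp)
  have h5 : ∀ᵐ z : Space n, ∀ k, z ∉ A → Hsfn (x k) z = 0 := ae_all_iff.2 hx
  change ∀ᵐ z, z ∉ A → Hsfn p z = 0
  filter_upwards [h3, h5] with z h3 h5 hz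
  refine tendsto_nhds_unique h3 ?_
  simp only [Function.comp_def, HsfnL_apply, h5 _ hz]
  exact tendsto_const_nhds

theorem HsTilde_mono {A B : Set (Space n)} (h : A ⊆ B) :
    (HsTilde s A : Submodule ℝ (Hs n s)) ≤ HsTilde s B := by
  intro v hv
  have hv : ∀ᵐ x, x ∉ A → Hsfn v x = 0 := hv
  change ∀ᵐ x, x ∉ B → Hsfn v x = 0
  filter_upwards [hv] with x hx hB
  exact hx fun hA => hB (h hA)

/-! ### The energy form -/

theorem rpow_kernel_mul_self (hs0 : 0 < s) {r : ℝ} (hr : 0 ≤ r) :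
    r ^ ((n : ℝ) / 2 + s) * r ^ ((n : ℝ) / 2 + s) = r ^ ((n : ℝ) + 2 * s) := by
  rw [← Real.rpow_add' hr (by positivity)]
  congr 1
  ring

/-- Splitting the kernel as a square makes the energy an inner product of images under `HsquotL`;
the abstract variational lemmas apply in this form. -/
theorem fracForm_eq_inner (hs0 : 0 < s) (u v : Hs n s) :
    fracForm u v = fracConst n s / 2 * inner ℝ (HsquotL u) (HsquotL v) := by
  rw [fracForm, L2.inner_def]
  congr 1
  refine integral_congr_ae ?_
  filter_upwards [HsquotL_ae u, HsquotL_ae v] with z hu hv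
  rw [hu, hv, diffQuot, diffQuot, ← rpow_kernel_mul_self hs0 (norm_nonneg _)]
  simp only [RCLike.inner_apply, conj_trivial]
  rw [div_mul_div_comm, mul_comm (Hsfn v z.1 - _)]

theorem fracConst_pos (hs0 : 0 < s) (hs1 : s < 1) : 0 < fracConst n s := by
  -- For `s` in (0,1) the point `-s` avoids the poles of Gamma, where `Real.Gamma` takes the default
  -- value 0.
  have h1 : Real.Gamma (-s) ≠ 0 := by
    refine Real.Gamma_ne_zero fun m hm => ?_
    have h : s = m := by linarith
    rw [h] at hs0 hs1
    have h0 : 0 < m := by exact_mod_cast hs0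
    have h1 : m < 1 := by exact_mod_cast hs1
    omega
  have h2 : 0 < Real.Gamma ((n : ℝ) / 2 + s) := Real.Gamma_pos_of_pos (by positivity)
  have h3 : 0 < |Real.Gamma (-s)| := abs_pos.2 h1
  unfold fracConst
  have := Real.pi_pos
  positivity

theorem enorm_sq_eq_ofReal (x : ℝ) : ‖x‖ₑ ^ 2 = ENNReal.ofReal (x ^ 2) := by
  rw [← ofReal_norm, ← ENNReal.ofReal_pow (norm_nonneg _), Real.norm_eq_abs, sq_abs]

/-- In the double integral keep only the pairs with second point in `A`. There `v` vanishes at that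
point, and whenever the first point lies in `O` the kernel is at least `R ^ (-(n + 2s))`. -/
theorem mul_norm_sq_le_of_dist_le (hs0 : 0 < s) {O A : Set (Space n)} (hA : MeasurableSet A)
    (hAO : ∀ y ∈ A, y ∉ O) {R : ℝ} (hR : 0 < R)
    (hdist : ∀ x ∈ O, ∀ y ∈ A, ‖x - y‖ ≤ R) {v : Hs n s} (hv : ∀ᵐ x, x ∉ O → Hsfn v x = 0) :
    (volume A).toReal * (R ^ ((n : ℝ) + 2 * s))⁻¹ * ‖Hsfn v‖ ^ 2 ≤ ‖HsquotL v‖ ^ 2 := by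
  have hM0 : 0 ≤ (R ^ ((n : ℝ) + 2 * s))⁻¹ := by positivity
  have hsm : Measurable (fun x => ‖Hsfn v x‖ₑ ^ 2) :=
    (Lp.stronglyMeasurable (Hsfn v)).measurable.enorm.pow_const 2
  have key : ∫⁻ z : Space n × Space n, (‖Hsfn v z.1‖ₑ ^ 2) * (A.indicator
      (fun _ => ENNReal.ofReal (R ^ ((n : ℝ) + 2 * s))⁻¹) z.2) ≤
        ∫⁻ z, ‖HsquotL v z‖ₑ ^ 2 := by
    refine lintegral_mono_ae ?_
    filter_upwards [HsquotL_ae v, ae_prod_of_ae hv] with z hz hz'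
    by_cases hzA : z.2 ∈ A
    · by_cases hzO : z.1 ∈ O
      · rw [hz, diffQuot, hz'.2 (hAO _ hzA), sub_zero, enorm_sq_eq_ofReal, enorm_sq_eq_ofReal,
          indicator_of_mem hzA, ← ENNReal.ofReal_mul (sq_nonneg _)]
        refine ENNReal.ofReal_le_ofReal ?_
        have hne : 0 < ‖z.1 - z.2‖ := by
          rw [norm_pos_iff, sub_ne_zero]
          intro h
          exact hAO _ hzA (h ▸ hzO)
        rw [div_pow, div_eq_mul_inv, sq (_ ^ _ : ℝ), rpow_kernel_mul_self hs0 hne.le]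
        gcongr
        exact hdist _ hzO _ hzA
      · simp [hz'.1 hzO]
    · simp [indicator_of_notMem hzA]
  have e := lintegral_prod_mul (μ := volume) (ν := volume) (f := fun x => ‖Hsfn v x‖ₑ ^ 2)
    hsm.aemeasurable (measurable_const (a := ENNReal.ofReal (R ^ ((n : ℝ) + 2 * s))⁻¹)
      |>.indicator hA).aemeasurable
  rw [lintegral_indicator hA, setLIntegral_const, ← enorm_sq_eq_lintegral] at e
  replace key := e.symm.trans_le (key.trans_eq (enorm_sq_eq_lintegral _).symm)
  have key' := ENNReal.toReal_mono (ENNReal.pow_ne_top enorm_ne_top) key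
  simp only [ENNReal.toReal_mul, ENNReal.toReal_pow, toReal_enorm,
    ENNReal.toReal_ofReal hM0] at key'
  linarith

/-- The fractional Poincaré inequality for functions vanishing outside a bounded set. -/
theorem exists_poincare (hn : 1 ≤ n) (hs0 : 0 < s) {O : Set (Space n)}
    (hO : Bornology.IsBounded O) : ∃ c : ℝ, 0 < c ∧ ∀ v ∈ (HsTilde s O : Submodule ℝ (Hs n s)),
      c * ‖Hsfn v‖ ^ 2 ≤ ‖HsquotL v‖ ^ 2 := by
  obtain ⟨R, hR0, hR⟩ := hO.subset_ball_lt 0 0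
  have : Nonempty (Fin n) := ⟨⟨0, hn⟩⟩
  -- The unit ball about a point of norm `R + 1` misses the ball of radius `R` containing `O`, and
  -- its points are within `2R + 2` of those of `O`.
  obtain ⟨a, ha⟩ := exists_norm_eq (Space n) (by positivity : (0 : ℝ) ≤ R + 1)
  have hA0 : 0 < (volume (Metric.ball a 1)).toReal :=
    ENNReal.toReal_pos (Metric.measure_ball_pos _ _ one_pos).ne' measure_ball_lt_top.ne
  refine ⟨(volume (Metric.ball a 1)).toReal * ((2 * R + 2) ^ ((n : ℝ) + 2 * s))⁻¹, by positivity,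
    fun v hv => mul_norm_sq_le_of_dist_le hs0 (O := O) measurableSet_ball
      ?_ (by positivity) ?_ hv⟩
  · intro y hy hyO
    have h1 := mem_ball_zero_iff.1 (hR hyO)
    have h2 : ‖a - y‖ < 1 := by rw [← dist_eq_norm, dist_comm]; exact hy
    have h3 := norm_sub_norm_le a y
    linarith
  · intro x hx y hy
    have h1 := mem_ball_zero_iff.1 (hR hx)
    have h2 : ‖a - y‖ < 1 := by rw [← dist_eq_norm, dist_comm]; exact hy
    have h3 : ‖x - y‖ ≤ ‖x‖ + ‖y‖ := norm_sub_le x y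
    have h4 : ‖y‖ ≤ ‖a‖ + ‖a - y‖ := by
      have := norm_sub_le a (a - y)
      rwa [sub_sub_cancel] at this
    linarith

/-- The energy form controls the norm on functions vanishing outside a bounded set. -/
theorem exists_coercive (hn : 1 ≤ n) (hs0 : 0 < s) (hs1 : s < 1) {O : Set (Space n)}
    (hO : Bornology.IsBounded O) : ∃ c : ℝ, 0 < c ∧ ∀ v ∈ (HsTilde s O : Submodule ℝ (Hs n s)),
      c * ‖v‖ ^ 2 ≤ fracForm v v := by
  obtain ⟨c, hc, h⟩ := exists_poincare hn hs0 hO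
  have hk : 0 < fracConst n s / 2 := half_pos (fracConst_pos hs0 hs1)
  -- With `a`, `q` the L² norms of `v` and its quotient, `c a² ≤ q²` gives `c (a² + q²) ≤ (c + 1)
  -- q²`.
  refine ⟨fracConst n s / 2 * (c / (c + 1)), by positivity, fun v hv => ?_⟩
  rw [fracForm_eq_inner hs0, real_inner_self_eq_norm_sq, mul_assoc]
  refine mul_le_mul_of_nonneg_left ?_ hk.le
  rw [Hs_norm_sq, div_mul_eq_mul_div, div_le_iff₀ (by positivity)]
  have := h v hv
  nlinarith

end Basic

/-! ### Weak limits in closed subspaces, Lax–Milgram, Céa's lemma, and reduction to a density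
statement. -/

section WellPosed

/-! ### Weak limits and closed subspaces -/

theorem WeaklyTendsto.tendsto_apply {ι X : Type*} [NormedAddCommGroup X] [NormedSpace ℝ X]
    {u : ι → X} {l : Filter ι} {a : X} (h : WeaklyTendsto u l a) (F : X →L[ℝ] ℝ) :
    Tendsto (fun i => F (u i)) l (𝓝 (F a)) :=
  ((WeakBilin.eval_continuous (topDualPairing ℝ X).flip F).tendsto _).comp h

theorem weaklyTendsto_of_tendsto {ι X : Type*} [NormedAddCommGroup X] [NormedSpace ℝ X]
    {u : ι → X} {l : Filter ι} {a : X} (h : Tendsto u l (𝓝 a)) : WeaklyTendsto u l a :=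
  ((toWeakSpaceCLM ℝ X).continuous.tendsto a).comp h

theorem mem_of_inner_eq_zero {H : Type*} [NormedAddCommGroup H] [InnerProductSpace ℝ H]
    [CompleteSpace H] {W : Submodule ℝ H} (hW : IsClosed (W : Set H)) {x : H}
    (h : ∀ p ∈ Wᗮ, inner ℝ p x = 0) : x ∈ W := by
  have : CompleteSpace W := hW.completeSpace_coe
  rw [← Submodule.orthogonal_orthogonal W]
  exact h

/-- A closed subspace contains the images of weak limits under bounded operators. -/
theorem WeaklyTendsto.map_mem {ι X H : Type*} [NormedAddCommGroup X] [NormedSpace ℝ X]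
    [NormedAddCommGroup H] [InnerProductSpace ℝ H] [CompleteSpace H] {u : ι → X} {l : Filter ι}
    [l.NeBot] {a : X} (h : WeaklyTendsto u l a) (M : X →L[ℝ] H) {W : Submodule ℝ H}
    (hW : IsClosed (W : Set H)) (hu : ∀ᶠ i in l, M (u i) ∈ W) : M a ∈ W := by
  refine mem_of_inner_eq_zero hW fun p hp => ?_
  refine tendsto_nhds_unique (h.tendsto_apply ((innerSL ℝ p).comp M)) ?_
  refine tendsto_const_nhds.congr' ?_
  filter_upwards [hu] with i hi
  exact ((Submodule.mem_orthogonal' W p).1 hp _ hi).symm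

/-- A closed subspace contains the limits of its bounded sequences with respect to a weaker
Hilbert space topology. -/
theorem mem_of_tendsto_of_bounded {H L : Type*} [NormedAddCommGroup H] [InnerProductSpace ℝ H]
    [CompleteSpace H] [NormedAddCommGroup L] [InnerProductSpace ℝ L] [CompleteSpace L]
    {A : H →L[ℝ] L} (hA : Function.Injective A) {W : Submodule ℝ H} (hW : IsClosed (W : Set H))
    {u : ℕ → H} (hu : ∀ k, u k ∈ W) {C : ℝ} (hC : ∀ k, ‖u k‖ ≤ C) {x : H}
    (hx : Tendsto (fun k => A (u k)) atTop (𝓝 (A x))) : x ∈ W := by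
  refine mem_of_inner_eq_zero hW fun p hp => ?_
  -- Injectivity of `A` makes the range of its adjoint dense, so `p` is nearly `A* ψ`. Pairing with
  -- `A* ψ` sees only convergence in `L`, and boundedness of the sequence controls the error; each
  -- contributes less than half of `|⟨p, x⟩|`.
  have hd : (ContinuousLinearMap.adjoint A).range.topologicalClosure = ⊤ := by
    rw [← A.orthogonal_ker, LinearMap.ker_eq_bot.2 hA, Submodule.bot_orthogonal_eq_top]
  have hp' : p ∈ closure ((ContinuousLinearMap.adjoint A).range : Set H) := by
    rw [← Submodule.topologicalClosure_coe, hd]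
    trivial
  have hC0 : 0 ≤ C := (norm_nonneg _).trans (hC 0)
  by_contra hne
  have hpos : 0 < |inner ℝ p x| := abs_pos.2 hne
  obtain ⟨q, ⟨ψ, hψ⟩, hq⟩ := Metric.mem_closure_iff.1 hp'
    (|inner ℝ p x| / (2 * (‖x‖ + C + 1))) (by positivity)
  rw [dist_eq_norm, lt_div_iff₀ (by positivity)] at hq
  have hlim : Tendsto (fun k => inner ℝ ψ (A x - A (u k))) atTop (𝓝 0) := by
    have := (tendsto_const_nhds (x := ψ)).inner (𝕜 := ℝ) ((tendsto_const_nhds (x := A x)).sub hx)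
    simpa using this
  obtain ⟨k, hk⟩ := ((Metric.tendsto_nhds.1 hlim) _ (half_pos hpos)).exists
  rw [Real.dist_eq, sub_zero] at hk
  have e : inner ℝ p x = inner ℝ (p - q) (x - u k) + inner ℝ ψ (A x - A (u k)) := by
    rw [← map_sub, ← ContinuousLinearMap.adjoint_inner_left]
    change _ = _ + inner ℝ ((ContinuousLinearMap.adjoint A : L →ₗ[ℝ] H) ψ) _
    rw [hψ, ← inner_add_left, sub_add_cancel, inner_sub_right,
      (Submodule.mem_orthogonal' W p).1 hp _ (hu k), sub_zero]
  have h1 : |inner ℝ (p - q) (x - u k)| ≤ ‖p - q‖ * (‖x‖ + C + 1) := by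
    refine (abs_real_inner_le_norm _ _).trans (mul_le_mul_of_nonneg_left ?_ (norm_nonneg _))
    have := norm_sub_le x (u k)
    linarith [hC k]
  have h2 : |inner ℝ p x| ≤ |inner ℝ (p - q) (x - u k)| + |inner ℝ ψ (A x - A (u k))| := by
    rw [e]
    exact abs_add_le _ _
  linarith

/-! ### Well-posedness and quasi-optimality -/

section Abstract

variable {H K : Type*} [NormedAddCommGroup H] [InnerProductSpace ℝ H]
  [NormedAddCommGroup K] [InnerProductSpace ℝ K]

/-- Lax–Milgram on `V` for the unknown `u - g`, with the energy of `g` moved to the right-hand side.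
-/
theorem exists_variational_solution [CompleteSpace H] {Q : H →L[ℝ] K} {κ c : ℝ} {V : Submodule ℝ H}
    (hV : IsClosed (V : Set H)) (hc : 0 < c)
    (h : ∀ v ∈ V, c * ‖v‖ ^ 2 ≤ κ * inner ℝ (Q v) (Q v)) (f : V →L[ℝ] ℝ) (g : H) :
    ∃ u : H, u - g ∈ V ∧ ∀ w : V, κ * inner ℝ (Q u) (Q w) = f w := by
  have : CompleteSpace V := hV.completeSpace_coe
  let R : V →L[ℝ] K := Q.comp V.subtypeL
  let B : V →L[ℝ] V →L[ℝ] ℝ := κ • (innerSL ℝ).bilinearComp R R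
  have hB : ∀ v w : V, B v w = κ * inner ℝ (Q v) (Q w) := fun v w => rfl
  have hBc : IsCoercive B := by
    refine ⟨c, hc, fun v => ?_⟩
    rw [hB, mul_assoc, ← sq]
    exact h v v.2
  let F : V →L[ℝ] ℝ := f - κ • (innerSL ℝ (Q g)).comp R
  have hF : ∀ w : V, F w = f w - κ * inner ℝ (Q g) (Q w) := fun w => rfl
  set v := hBc.continuousLinearEquivOfBilin.symm ((InnerProductSpace.toDual ℝ _).symm F) with hv
  have hvF : ∀ w, B v w = F w := fun w => by
    rw [← hBc.continuousLinearEquivOfBilin_apply, hv,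
      ContinuousLinearEquiv.apply_symm_apply, InnerProductSpace.toDual_symm_apply]
  refine ⟨v + g, by simp, fun w => ?_⟩
  have h := hvF w
  rw [hB, hF] at h
  rw [map_add, inner_add_left]
  linarith

/-- Céa's lemma: the error `u - u₀` is energy-orthogonal to `A`, so in one slot of its own energy it
may be replaced by `w - (u₀ - g)` for any `w` in `A`. Coercivity and Cauchy–Schwarz then leave one
factor `‖u - u₀‖` to cancel. -/
theorem norm_sub_le_of_variational_solutions {Q : H →L[ℝ] K} {κ c : ℝ} {V A : Submodule ℝ H}
    (hA : A ≤ V) (hc : 0 < c) (hκ : 0 ≤ κ) (hQ : ∀ x, ‖Q x‖ ≤ ‖x‖)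
    (h : ∀ v ∈ V, c * ‖v‖ ^ 2 ≤ κ * inner ℝ (Q v) (Q v)) {g u u₀ : H}
    (hu : u - g ∈ A) (hu₀ : u₀ - g ∈ V) (horth : ∀ z ∈ A, inner ℝ (Q u) (Q z) = inner ℝ (Q u₀) (Q z))
    {w : H} (hw : w ∈ A) : ‖u - u₀‖ ≤ κ / c * ‖(u₀ - g) - w‖ := by
  have hdO : u - u₀ ∈ V := by
    have := V.sub_mem (hA hu) hu₀
    rwa [sub_sub_sub_cancel_right] at this
  have e : inner ℝ (Q (u - u₀)) (Q (u - u₀)) = inner ℝ (Q (u - u₀)) (Q (w - (u₀ - g))) := by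
    have h1 := horth _ (A.sub_mem hu hw)
    have h2 : u - u₀ = (u - g - w) + (w - (u₀ - g)) := by abel
    have h3 : inner ℝ (Q (u - u₀)) (Q (u - g - w)) = 0 := by
      rw [map_sub Q u u₀, inner_sub_left, h1, sub_self]
    calc inner ℝ (Q (u - u₀)) (Q (u - u₀))
        = inner ℝ (Q (u - u₀)) (Q ((u - g - w) + (w - (u₀ - g)))) := by rw [← h2]
      _ = _ := by rw [map_add Q (u - g - w), inner_add_right, h3, zero_add]
  have h5 := h _ hdO
  have h6 : inner ℝ (Q (u - u₀)) (Q (u - u₀)) ≤ ‖u - u₀‖ * ‖(u₀ - g) - w‖ := by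
    rw [e, norm_sub_rev (u₀ - g)]
    exact (real_inner_le_norm _ _).trans
      (mul_le_mul (hQ _) (hQ _) (norm_nonneg _) (norm_nonneg _))
  have h7 := h5.trans (mul_le_mul_of_nonneg_left h6 hκ)
  rw [div_mul_eq_mul_div, le_div_iff₀ hc]
  rcases (norm_nonneg (u - u₀)).eq_or_lt with h0 | h0
  · rw [← h0, zero_mul]
    positivity
  · nlinarith

end Abstract

variable {n : ℕ} {s : ℝ}

theorem norm_HsquotL_le (u : Hs n s) : ‖HsquotL u‖ ≤ ‖u‖ := by
  have := Hs_norm_sq u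
  refine abs_le_of_sq_le_sq' ?_ (norm_nonneg _) |>.2
  nlinarith [sq_nonneg ‖Hsfn u‖]

theorem exists_isWeakSolution (hn : 1 ≤ n) (hs0 : 0 < s) (hs1 : s < 1) {O : Set (Space n)}
    (hO : Bornology.IsBounded O) (f : HsTilde s O →L[ℝ] ℝ) (g : Hs n s) :
    ∃ u : Hs n s, IsWeakSolution f g O u := by
  obtain ⟨c, hc, h⟩ := exists_coercive hn hs0 hs1 hO
  simp only [fracForm_eq_inner hs0] at h
  obtain ⟨u, hu1, hu2⟩ := exists_variational_solution (isClosed_HsTilde O) hc h f g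
  refine ⟨u, hu1, fun w _ => ?_⟩
  rw [fracForm_eq_inner hs0, hu2]

/-- Galerkin orthogonality: a function vanishing outside `A` is admissible in both problems. -/
theorem IsWeakSolution.inner_eq (hs0 : 0 < s) (hs1 : s < 1) {O A : Set (Space n)}
    {f : HsTilde s O →L[ℝ] ℝ} {g u u₀ : Hs n s} (hu₀ : IsWeakSolution f g O u₀) (hA : A ⊆ O)
    (hu : IsWeakSolution f g A u) (z : Hs n s) (hz : z ∈ (HsTilde s A : Submodule ℝ (Hs n s))) :
    inner ℝ (HsquotL u) (HsquotL z) = inner ℝ (HsquotL u₀) (HsquotL z) := by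
  have hz' : z ∈ (HsTilde s O : Submodule ℝ (Hs n s)) := HsTilde_mono hA hz
  have e := (hu.2 ⟨z, hz'⟩ hz).trans (hu₀.2 ⟨z, hz'⟩ hz').symm
  rw [fracForm_eq_inner hs0, fracForm_eq_inner hs0] at e
  exact mul_left_cancel₀ (half_pos (fracConst_pos hs0 hs1)).ne' e

set_option maxHeartbeats 400000 in
/-- The error of the solution in a smaller set is controlled by the best approximation error. -/
theorem exists_norm_sub_le (hn : 1 ≤ n) (hs0 : 0 < s) (hs1 : s < 1) {O : Set (Space n)}
    (hO : Bornology.IsBounded O) (f : HsTilde s O →L[ℝ] ℝ) (g : Hs n s) {u₀ : Hs n s}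
    (hu₀ : IsWeakSolution f g O u₀) : ∃ C : ℝ, 0 < C ∧ ∀ A ⊆ O, ∀ u, IsWeakSolution f g A u →
      ∀ w ∈ (HsTilde s A : Submodule ℝ (Hs n s)), ‖u - u₀‖ ≤ C * ‖(u₀ - g) - w‖ := by
  obtain ⟨c, hc, h⟩ := exists_coercive hn hs0 hs1 hO
  simp only [fracForm_eq_inner hs0] at h
  have hk : 0 < fracConst n s / 2 := half_pos (fracConst_pos hs0 hs1)
  refine ⟨fracConst n s / 2 / c, by positivity, fun A hA u hu w hw => ?_⟩
  exact norm_sub_le_of_variational_solutions (Q := HsquotL) (V := HsTilde s O) (A := HsTilde s A)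
    (HsTilde_mono hA) hc hk.le norm_HsquotL_le h hu.1 hu₀.1
    (hu₀.inner_eq hs0 hs1 hA hu) hw

theorem IsWeakSolution.unique (hn : 1 ≤ n) (hs0 : 0 < s) (hs1 : s < 1) {O : Set (Space n)}
    (hO : Bornology.IsBounded O) {f : HsTilde s O →L[ℝ] ℝ} {g u v : Hs n s}
    (hu : IsWeakSolution f g O u) (hv : IsWeakSolution f g O v) : v = u := by
  obtain ⟨C, -, h⟩ := exists_norm_sub_le hn hs0 hs1 hO f g hu
  -- Céa's estimate with the competitor `u - g` has right-hand side zero.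
  have := h O Subset.rfl v hv _ hu.1
  rw [sub_self, norm_zero, mul_zero] at this
  exact sub_eq_zero.1 (norm_le_zero_iff.1 this)

theorem holes_mono (T : ℝ → Set (Space n)) {δ ε : ℝ} (h : δ ≤ ε) : holes T δ ⊆ holes T ε :=
  biUnion_subset_biUnion_left (Ioc_subset_Ioc_right h)

theorem perforated_anti (O : Set (Space n)) (T : ℝ → Set (Space n)) {δ ε : ℝ} (h : δ ≤ ε) :
    perforated O T ε ⊆ perforated O T δ :=
  sdiff_subset_sdiff_right (holes_mono T h)

theorem perforated_subset (O : Set (Space n)) (T : ℝ → Set (Space n)) (ε : ℝ) :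
    perforated O T ε ⊆ O :=
  sdiff_subset

/-- The closure of the functions that vanish on the holes `T_δ`, `0 < δ ≤ ε`, for some `ε > 0`. -/
noncomputable def perforatedClosure (s : ℝ) (O : Set (Space n)) (T : ℝ → Set (Space n)) :
    Submodule ℝ (Hs n s) :=
  (⨆ ε : Ioi (0 : ℝ), HsTilde s (perforated O T ε)).topologicalClosure

theorem isClosed_perforatedClosure (O : Set (Space n)) (T : ℝ → Set (Space n)) :
    IsClosed (perforatedClosure s O T : Set (Hs n s)) :=
  Submodule.isClosed_topologicalClosure _

theorem HsTilde_le_perforatedClosure (O : Set (Space n)) (T : ℝ → Set (Space n)) {ε : ℝ}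
    (hε : 0 < ε) : HsTilde s (perforated O T ε) ≤ perforatedClosure s O T :=
  (le_iSup (fun ε : Ioi (0 : ℝ) => HsTilde s (perforated O T ε)) ⟨ε, hε⟩).trans
    (Submodule.le_topologicalClosure _)

theorem exists_norm_sub_lt_of_mem_perforatedClosure {O : Set (Space n)} {T : ℝ → Set (Space n)}
    {v : Hs n s} (hv : v ∈ perforatedClosure s O T) {δ : ℝ} (hδ : 0 < δ) :
    ∃ ε > 0, ∃ w ∈ (HsTilde s (perforated O T ε) : Submodule ℝ (Hs n s)), ‖v - w‖ < δ := by
  have hv' : v ∈ closure ((⨆ ε : Ioi (0 : ℝ), HsTilde s (perforated O T ε) :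
    Submodule ℝ (Hs n s)) : Set (Hs n s)) := hv
  obtain ⟨w, hw, hd⟩ := Metric.mem_closure_iff.1 hv' δ hδ
  have : Nonempty (Ioi (0 : ℝ)) := ⟨⟨1, mem_Ioi.2 one_pos⟩⟩
  -- The subspaces are nested, so their supremum is a union and the approximant vanishes on the
  -- holes for a single `ε`.
  have hdir : Directed (· ≤ ·) fun ε : Ioi (0 : ℝ) =>
      (HsTilde s (perforated O T ε) : Submodule ℝ (Hs n s)) := by
    intro a b
    refine ⟨⟨min a.1 b.1, mem_Ioi.2 (lt_min a.2 b.2)⟩, ?_, ?_⟩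
    · exact HsTilde_mono (perforated_anti O T (min_le_left _ _))
    · exact HsTilde_mono (perforated_anti O T (min_le_right _ _))
  obtain ⟨ε, hε⟩ := (Submodule.mem_iSup_of_directed _ hdir).1 hw
  exact ⟨ε, ε.2, w, hε, by rwa [← dist_eq_norm]⟩

/-- One approximant of `u₀ - g`, admissible at level `ε`, stays admissible at every smaller level,
so Céa's estimate is uniform there. -/
theorem tendsto_of_mem_perforatedClosure (hn : 1 ≤ n) (hs0 : 0 < s) (hs1 : s < 1)
    {O : Set (Space n)} (hO : Bornology.IsBounded O) (T : ℝ → Set (Space n))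
    (f : HsTilde s O →L[ℝ] ℝ) (g : Hs n s) {u₀ : Hs n s} (hu₀ : IsWeakSolution f g O u₀)
    (hmem : u₀ - g ∈ perforatedClosure s O T) {u : ℝ → Hs n s}
    (hu : ∀ ε > 0, IsWeakSolution f g (perforated O T ε) (u ε)) :
    Tendsto u (𝓝[>] 0) (𝓝 u₀) := by
  obtain ⟨C, hC, h⟩ := exists_norm_sub_le hn hs0 hs1 hO f g hu₀
  refine Metric.tendsto_nhds.2 fun δ hδ => ?_
  obtain ⟨ε, hε, w, hw, hd⟩ := exists_norm_sub_lt_of_mem_perforatedClosure hmem (div_pos hδ hC)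
  filter_upwards [Ioc_mem_nhdsGT hε] with t ht
  rw [dist_eq_norm]
  refine (h _ (perforated_subset O T t) _ (hu t ht.1) w
    (HsTilde_mono (perforated_anti O T ht.2) hw)).trans_lt ?_
  rw [lt_div_iff₀ hC] at hd
  linarith

end WellPosed

/-! ### From the L² modulus of continuity to the seminorm; Lipschitz multipliers. -/

section Seminorm

variable {n : ℕ} {s : ℝ}

/-! ### Gagliardo seminorm estimates -/

/-- The function `min(|z|², 1) / |z|^{n + 2s}` on `ℝⁿ`. -/
noncomputable def truncKernel (n : ℕ) (s : ℝ) (z : Space n) : ℝ :=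
  min (‖z‖ ^ 2) 1 / ‖z‖ ^ ((n : ℝ) + 2 * s)

theorem truncKernel_nonneg (z : Space n) : 0 ≤ truncKernel n s z := by
  unfold truncKernel
  positivity

theorem measurable_truncKernel : Measurable (truncKernel n s) := by
  unfold truncKernel
  exact ((measurable_norm.pow_const 2).min measurable_const).div (measurable_norm.pow_const _)

/-- In polar coordinates the density is `r ^ (1 - 2s)` near 0, integrable as `s < 1`, and `r ^ (-1 -
2s)` beyond 1, integrable as `s > 0`. -/
theorem integrable_truncKernel (hn : 1 ≤ n) (hs0 : 0 < s) (hs1 : s < 1) :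
    Integrable (truncKernel n s) := by
  have : Nonempty (Fin n) := ⟨⟨0, hn⟩⟩
  have key : IntegrableOn (fun r : ℝ => r ^ (Module.finrank ℝ (Space n) - 1) •
      (min (r ^ 2) 1 / r ^ ((n : ℝ) + 2 * s))) (Ioi 0) := by
    rw [finrank_euclideanSpace_fin, ← Ioc_union_Ioi_eq_Ioi zero_le_one]
    have hpow : ∀ r : ℝ, 0 < r → r ^ (n - 1) / r ^ ((n : ℝ) + 2 * s) = r ^ (-1 - 2 * s) := by
      intro r hr
      rw [← Real.rpow_natCast, ← Real.rpow_sub hr, Nat.cast_sub hn]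
      congr 1
      push_cast
      ring
    refine IntegrableOn.union ?_ ?_
    · have h1 : IntegrableOn (fun r : ℝ => r ^ (1 - 2 * s)) (Ioc 0 1) := by
        rw [← intervalIntegrable_iff_integrableOn_Ioc_of_le zero_le_one]
        exact intervalIntegral.intervalIntegrable_rpow' (by linarith)
      refine h1.congr_fun (fun r hr => ?_) measurableSet_Ioc
      have hr2 : r ^ 2 ≤ 1 := pow_le_one₀ hr.1.le hr.2
      simp only [min_eq_left hr2, smul_eq_mul]
      rw [mul_div_left_comm, hpow r hr.1, ← Real.rpow_natCast, ← Real.rpow_add hr.1]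
      congr 1
      push_cast
      ring
    · have h1 : IntegrableOn (fun r : ℝ => r ^ (-1 - 2 * s)) (Ioi 1) :=
        integrableOn_Ioi_rpow_of_lt (by linarith) one_pos
      refine h1.congr_fun (fun r hr => ?_) measurableSet_Ioi
      have hr1 : 1 < r := hr
      have hr2 : 1 ≤ r ^ 2 := one_le_pow₀ hr1.le
      simp only [min_eq_right hr2, smul_eq_mul]
      rw [mul_one_div, hpow r (by linarith)]
  exact (integrable_fun_norm_addHaar (volume : Measure (Space n))
    (f := fun r : ℝ => min (r ^ 2) 1 / r ^ ((n : ℝ) + 2 * s))).2 key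

theorem lintegral_truncKernel_lt_top (hn : 1 ≤ n) (hs0 : 0 < s) (hs1 : s < 1) :
    ∫⁻ z, ENNReal.ofReal (truncKernel n s z) < ⊤ :=
  (integrable_truncKernel hn hs0 hs1).lintegral_lt_top

theorem enorm_diffQuot_sq (hs0 : 0 < s) (v : Space n → ℝ) (x y : Space n) :
    ‖diffQuot s v (x, y)‖ₑ ^ 2 =
      ENNReal.ofReal (‖x - y‖ ^ ((n : ℝ) + 2 * s))⁻¹ * ‖v x - v y‖ₑ ^ 2 := by
  rw [enorm_sq_eq_ofReal, enorm_sq_eq_ofReal, ← ENNReal.ofReal_mul (by positivity), diffQuot,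
    div_pow, sq (_ ^ _ : ℝ), rpow_kernel_mul_self hs0 (norm_nonneg _), div_eq_inv_mul]

/-- A bound for the `L²` modulus of continuity gives a bound for the Gagliardo seminorm. -/
theorem lintegral_diffQuot_le_of_shift (hs0 : 0 < s) {v : Space n → ℝ} (hv : Measurable v) {C : ℝ}
    (hC : 0 ≤ C)
    (h : ∀ z, ∫⁻ y, ‖v (y + z) - v y‖ₑ ^ 2 ≤ ENNReal.ofReal (C * min (‖z‖ ^ 2) 1)) :
    ∫⁻ p, ‖diffQuot s v p‖ₑ ^ 2 ≤
      ENNReal.ofReal C * ∫⁻ z, ENNReal.ofReal (truncKernel n s z) := by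
  have hm : Measurable fun p : Space n × Space n =>
      ENNReal.ofReal (‖p.1‖ ^ ((n : ℝ) + 2 * s))⁻¹ * ‖v (p.2 + p.1) - v p.2‖ₑ ^ 2 := by
    fun_prop
  have hm' : Measurable fun p : Space n × Space n => ‖diffQuot s v p‖ₑ ^ 2 := by
    unfold diffQuot
    fun_prop
  calc ∫⁻ p, ‖diffQuot s v p‖ₑ ^ 2
      = ∫⁻ y, ∫⁻ x, ‖diffQuot s v (x, y)‖ₑ ^ 2 := by
        rw [Measure.volume_eq_prod, lintegral_prod_symm _ hm'.aemeasurable]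
    _ = ∫⁻ y, ∫⁻ z, ENNReal.ofReal (‖z‖ ^ ((n : ℝ) + 2 * s))⁻¹ * ‖v (y + z) - v y‖ₑ ^ 2 := by
        refine lintegral_congr fun y => ?_
        rw [← lintegral_add_left_eq_self _ y]
        refine lintegral_congr fun z => ?_
        rw [enorm_diffQuot_sq hs0, add_sub_cancel_left]
    _ = ∫⁻ z, ∫⁻ y, ENNReal.ofReal (‖z‖ ^ ((n : ℝ) + 2 * s))⁻¹ * ‖v (y + z) - v y‖ₑ ^ 2 := by
        rw [lintegral_lintegral_swap]
        exact (hm.comp measurable_swap).aemeasurable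
    _ ≤ ∫⁻ z, ENNReal.ofReal C * ENNReal.ofReal (truncKernel n s z) := by
        refine lintegral_mono fun z => ?_
        rw [lintegral_const_mul' _ _ ENNReal.ofReal_ne_top]
        refine (mul_le_mul_right (h z) _).trans_eq ?_
        rw [← ENNReal.ofReal_mul (by positivity), ← ENNReal.ofReal_mul hC, truncKernel]
        congr 1
        rw [div_eq_mul_inv]
        ring
    _ = _ := lintegral_const_mul' _ _ ENNReal.ofReal_ne_top

/-- Bounded Lipschitz functions are multipliers of `Hˢ(ℝⁿ)`. -/
theorem exists_mul_Hs (hn : 1 ≤ n) (hs0 : 0 < s) (hs1 : s < 1) {ψ : Space n → ℝ} {M : ℝ}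
    (hM : ∀ x, |ψ x| ≤ M) {L : ℝ≥0} (hL : LipschitzWith L ψ) (u : Hs n s) :
    ∃ v : Hs n s, Hsfn v =ᵐ[volume] fun x => ψ x * Hsfn u x := by
  have hM0 : 0 ≤ M := (abs_nonneg _).trans (hM 0)
  have hum := (Lp.stronglyMeasurable (Hsfn u)).measurable
  have hψm := hL.continuous.measurable
  -- The difference of `ψ` at two points is at most `L ‖x - y‖` and at most `2M`, hence at most `(L
  -- + 2M) min(‖x - y‖, 1)`.
  set C : ℝ := (L + 2 * M) ^ 2 with hC
  have hψ2 : ∀ x y, (ψ x - ψ y) ^ 2 ≤ C * min (‖x - y‖ ^ 2) 1 := by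
    intro x y
    have h1 : |ψ x - ψ y| ≤ L * ‖x - y‖ := by
      simpa [Real.dist_eq, dist_eq_norm] using hL.dist_le_mul x y
    have h2 : |ψ x - ψ y| ≤ 2 * M := by
      have := abs_sub (ψ x) (ψ y)
      linarith [hM x, hM y]
    have hL0 : (0 : ℝ) ≤ L := L.2
    rw [← sq_abs]
    rcases min_cases (‖x - y‖ ^ 2) 1 with h | h
    · rw [h.1, hC, ← mul_pow]
      gcongr
      nlinarith [norm_nonneg (x - y)]
    · rw [h.1, hC, mul_one]
      gcongr
      linarith
  refine exists_Hs_of_memLp ?_ ?_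
  · exact (Lp.memLp (Hsfn u)).mul' (memLp_top_of_bound hψm.aestronglyMeasurable M
      (Eventually.of_forall hM))
  · refine memLp_two_of_lintegral_lt_top
      (measurable_diffQuot (hψm.mul hum).aestronglyMeasurable) ?_
    -- Write `ψ(x)u(x) - ψ(y)u(y) = ψ(x)(u(x) - u(y)) + (ψ(x) - ψ(y))u(y)` and use `(a + b)² ≤ 2a² +
    -- 2b²`.
    have hb : ∀ p : Space n × Space n, ‖diffQuot s (fun x => ψ x * Hsfn u x) p‖ₑ ^ 2 ≤
        ENNReal.ofReal (2 * M ^ 2) * ‖diffQuot s (Hsfn u) p‖ₑ ^ 2 +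
        ENNReal.ofReal (2 * C) * (ENNReal.ofReal (truncKernel n s (p.1 - p.2)) *
          ‖Hsfn u p.2‖ₑ ^ 2) := by
      rintro ⟨x, y⟩
      simp only [enorm_diffQuot_sq hs0, enorm_sq_eq_ofReal]
      rw [← ENNReal.ofReal_mul (by positivity), ← ENNReal.ofReal_mul (by positivity),
        ← ENNReal.ofReal_mul (by positivity), ← ENNReal.ofReal_mul (truncKernel_nonneg _),
        ← ENNReal.ofReal_mul (by positivity),
        ← ENNReal.ofReal_add (by positivity)
          (mul_nonneg (by positivity) (mul_nonneg (truncKernel_nonneg _) (sq_nonneg _)))]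
      refine ENNReal.ofReal_le_ofReal ?_
      have e : 2 * M ^ 2 * ((‖x - y‖ ^ ((n : ℝ) + 2 * s))⁻¹ * (Hsfn u x - Hsfn u y) ^ 2) +
          2 * C * (truncKernel n s (x - y) * Hsfn u y ^ 2) =
          (‖x - y‖ ^ ((n : ℝ) + 2 * s))⁻¹ * (2 * (M ^ 2 * (Hsfn u x - Hsfn u y) ^ 2) +
            2 * (C * min (‖x - y‖ ^ 2) 1 * Hsfn u y ^ 2)) := by
        rw [truncKernel, div_eq_mul_inv]
        ring
      rw [e]
      refine mul_le_mul_of_nonneg_left ?_ (by positivity)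
      have h1 : (ψ x) ^ 2 ≤ M ^ 2 := by
        rw [← sq_abs]
        exact pow_le_pow_left₀ (abs_nonneg _) (hM x) 2
      have h2 := mul_le_mul_of_nonneg_right h1 (sq_nonneg (Hsfn u x - Hsfn u y))
      have h3 := mul_le_mul_of_nonneg_right (hψ2 x y) (sq_nonneg (Hsfn u y))
      nlinarith [sq_nonneg (ψ x * (Hsfn u x - Hsfn u y) - (ψ x - ψ y) * Hsfn u y)]
    refine (lintegral_mono hb).trans_lt ?_
    have hm1 : Measurable fun p : Space n × Space n => ‖diffQuot s (Hsfn u) p‖ₑ ^ 2 := by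
      unfold diffQuot
      fun_prop
    have hm2 : Measurable fun p : Space n × Space n =>
        ENNReal.ofReal (truncKernel n s (p.1 - p.2)) * ‖Hsfn u p.2‖ₑ ^ 2 :=
      (measurable_truncKernel.comp (measurable_fst.sub measurable_snd)).ennreal_ofReal.mul
        ((hum.comp measurable_snd).enorm.pow_const 2)
    rw [lintegral_add_left (hm1.const_mul _), lintegral_const_mul _ hm1, lintegral_const_mul _ hm2]
    refine ENNReal.add_lt_top.2 ⟨ENNReal.mul_lt_top ENNReal.ofReal_lt_top
      ((diffQuot_lintegral_le u).trans_lt ENNReal.ofReal_lt_top),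
      ENNReal.mul_lt_top ENNReal.ofReal_lt_top ?_⟩
    rw [Measure.volume_eq_prod, lintegral_prod_symm _ hm2.aemeasurable]
    have e : ∀ y, ∫⁻ x, ENNReal.ofReal (truncKernel n s (x - y)) * ‖Hsfn u y‖ₑ ^ 2 =
        (∫⁻ z, ENNReal.ofReal (truncKernel n s z)) * ‖Hsfn u y‖ₑ ^ 2 := by
      intro y
      rw [lintegral_mul_const' _ _ (by finiteness),
        lintegral_sub_right_eq_self (fun z => ENNReal.ofReal (truncKernel n s z)) y]
    simp only [e]
    rw [lintegral_const_mul' _ _ (lintegral_truncKernel_lt_top hn hs0 hs1).ne]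
    exact ENNReal.mul_lt_top (lintegral_truncKernel_lt_top hn hs0 hs1)
      ((Hsfn_lintegral_le u).trans_lt ENNReal.ofReal_lt_top)

end Seminorm

/-! ### L² mean value inequality for weakly differentiable functions. -/

section Shift

variable {n : ℕ} {s : ℝ}

/-! ### Weak derivatives and translations -/

theorem norm_le_of_inner_le_dense {H : Type*} [NormedAddCommGroup H] [InnerProductSpace ℝ H]
    {D : Set H} (hD : Dense D) {d : H} {c : ℝ} (hc : 0 ≤ c)
    (h : ∀ ψ ∈ D, inner ℝ ψ d ≤ c * ‖ψ‖) :
    ‖d‖ ≤ c := by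
  have hcl : IsClosed {ψ : H | inner ℝ ψ d ≤ c * ‖ψ‖} :=
    isClosed_le (by fun_prop) (by fun_prop)
  have hd : inner ℝ d d ≤ c * ‖d‖ := hcl.closure_subset_iff.2 h (hD d)
  rw [real_inner_self_eq_norm_sq] at hd
  rcases (norm_nonneg d).eq_or_lt with h0 | h0
  · rwa [← h0]
  · nlinarith

theorem integral_mul_le_norm_mul_norm {α : Type*} [MeasurableSpace α] {μ : Measure α}
    {f g : α → ℝ} (hf : MemLp f 2 μ) (hg : MemLp g 2 μ) :
    |∫ x, f x * g x ∂μ| ≤ (eLpNorm f 2 μ).toReal * (eLpNorm g 2 μ).toReal := by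
  have e : ∫ x, f x * g x ∂μ = inner ℝ (hg.toLp g) (hf.toLp f) := by
    rw [L2.inner_def]
    refine integral_congr_ae ?_
    filter_upwards [hf.coeFn_toLp, hg.coeFn_toLp] with x h1 h2
    rw [h1, h2]
    simp
  rw [e, mul_comm]
  refine (abs_real_inner_le_norm _ _).trans_eq ?_
  rw [Lp.norm_toLp, Lp.norm_toLp]

theorem eLpNorm_comp_const_sub (f : Space n → ℝ) (hf : AEStronglyMeasurable f volume)
    (y : Space n) : eLpNorm (fun x => f (y - x)) 2 volume = eLpNorm f 2 volume :=
  eLpNorm_comp_measurePreserving hf (Measure.measurePreserving_sub_left volume y)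

theorem memLp_comp_const_sub {f : Space n → ℝ} (hf : MemLp f 2) (y : Space n) :
    MemLp (fun x => f (y - x)) 2 :=
  hf.comp_measurePreserving (Measure.measurePreserving_sub_left volume y)

theorem fderiv_comp_const_sub {ψ : Space n → ℝ} (hψ : ContDiff ℝ ∞ ψ) (y x z : Space n) :
    fderiv ℝ (fun t => ψ (y - t)) x z = -fderiv ℝ ψ (y - x) z := by
  have h1 : HasFDerivAt ψ (fderiv ℝ ψ (y - x)) (y - x) :=
    (hψ.differentiable (by simp) _).hasFDerivAt
  have h2 : HasFDerivAt (fun t : Space n => y - t) (-ContinuousLinearMap.id ℝ (Space n)) x :=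
    (hasFDerivAt_id x).const_sub y
  change fderiv ℝ (ψ ∘ fun t => y - t) x z = _
  rw [(h1.comp x h2).fderiv]
  simp

/-- If `k` is the weak derivative of `h` in the direction `z`, then the mean value inequality
holds for `h` in the `L²` sense; dual form. -/
theorem abs_integral_shift_sub_le {h k : Space n → ℝ} (hh : MemLp h 2) (hk : MemLp k 2)
    {z : Space n} (hder : ∀ ψ : Space n → ℝ, ContDiff ℝ ∞ ψ → HasCompactSupport ψ →
      ∫ x, h x * fderiv ℝ ψ x z = -∫ x, k x * ψ x)
    {ψ : Space n → ℝ} (hψ : ContDiff ℝ ∞ ψ) (hc : HasCompactSupport ψ) :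
    |∫ x, (h (z - x) - h (0 - x)) * ψ x| ≤
      (eLpNorm k 2 volume).toReal * (eLpNorm ψ 2 volume).toReal := by
  have hψ2 : MemLp ψ 2 := hψ.continuous.memLp_of_hasCompactSupport hc
  have hloc : LocallyIntegrable h := hh.locallyIntegrable (by norm_num)
  -- The integral to bound is `G z - G 0`. Along the segment `t • z`, the derivative of `G` is the
  -- pairing of `h` with a derivative of `ψ (y - ·)`; `hder` moves it onto `k`, and Cauchy–Schwarz
  -- bounds it uniformly.
  set G : Space n → ℝ := h ⋆[ContinuousLinearMap.mul ℝ ℝ, volume] ψ with hG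
  have hGd : ∀ y, HasFDerivAt G ((h ⋆[(ContinuousLinearMap.mul ℝ ℝ).precompR (Space n), volume]
      fderiv ℝ ψ) y) y := fun y => hc.hasFDerivAt_convolution_right _ hloc (hψ.of_le (by simp)) y
  have hb : ∀ y, |(h ⋆[(ContinuousLinearMap.mul ℝ ℝ).precompR (Space n), volume]
      fderiv ℝ ψ) y z| ≤ (eLpNorm k 2 volume).toReal * (eLpNorm ψ 2 volume).toReal := by
    intro y
    rw [convolution_precompR_apply _ hloc (hc.fderiv ℝ) (hψ.continuous_fderiv (by simp)),
      convolution_def]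
    simp only [ContinuousLinearMap.mul_apply']
    have e := hder (fun t => ψ (y - t)) (hψ.comp (contDiff_const.sub contDiff_id))
      (hc.comp_homeomorph (Homeomorph.subLeft y))
    simp only [fderiv_comp_const_sub hψ, mul_neg, integral_neg, neg_inj] at e
    rw [e]
    refine (integral_mul_le_norm_mul_norm hk (memLp_comp_const_sub hψ2 y)).trans_eq ?_
    rw [eLpNorm_comp_const_sub _ hψ2.1]
  have hF : ∀ t : ℝ, HasDerivAt (fun t : ℝ => G (t • z))
      ((h ⋆[(ContinuousLinearMap.mul ℝ ℝ).precompR (Space n), volume]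
      fderiv ℝ ψ) (t • z) z) t := by
    intro t
    have h1 : HasDerivAt (fun t : ℝ => t • z) z t := by
      simpa using (hasDerivAt_id t).smul_const z
    exact (hGd (t • z)).comp_hasDerivAt t h1
  have hmv := norm_image_sub_le_of_norm_deriv_le_segment_01'
    (fun t _ => (hF t).hasDerivWithinAt) (fun t _ => hb (t • z))
  have hGe : ∀ y, G y = ∫ x, h (y - x) * ψ x := fun y => by
    rw [hG, convolution_eq_swap]
    rfl
  have hint : ∀ y, Integrable fun x => h (y - x) * ψ x := fun y =>
    MemLp.integrable_mul (memLp_comp_const_sub hh y) hψ2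
  simp only [one_smul, zero_smul, hGe] at hmv
  rw [← integral_sub (hint z) (hint 0)] at hmv
  simp only [sub_mul]
  exact hmv

/-- Duality: the L² norm of the difference is tested against the dense set of test functions. The
reflection `x ↦ -x` converts the convolution form into a translation. -/
theorem lintegral_shift_sub_le {h k : Space n → ℝ} (hh : MemLp h 2) (hk : MemLp k 2)
    {z : Space n} (hder : ∀ ψ : Space n → ℝ, ContDiff ℝ ∞ ψ → HasCompactSupport ψ →
      ∫ x, h x * fderiv ℝ ψ x z = -∫ x, k x * ψ x) :
    ∫⁻ y, ‖h (y + z) - h y‖ₑ ^ 2 ≤ ∫⁻ y, ‖k y‖ₑ ^ 2 := by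
  have hd : MemLp (fun x => h (z - x) - h (0 - x)) 2 :=
    (memLp_comp_const_sub hh z).sub (memLp_comp_const_sub hh 0)
  have hle : ‖hd.toLp _‖ ≤ (eLpNorm k 2 volume).toReal := by
    refine norm_le_of_inner_le_dense (Lp.dense_hasCompactSupport_contDiff (by simp))
      ENNReal.toReal_nonneg ?_
    rintro f ⟨ψ, hf, hc, hψ⟩
    have hψ2 : MemLp ψ 2 := hψ.continuous.memLp_of_hasCompactSupport hc
    refine le_trans (le_of_eq ?_) ((le_abs_self _).trans
      ((abs_integral_shift_sub_le hh hk hder hψ hc).trans_eq ?_))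
    · rw [L2.inner_def]
      refine integral_congr_ae ?_
      filter_upwards [hf, hd.coeFn_toLp] with x h1 h2
      rw [h1, h2]
      simp
    · rw [Lp.norm_def, eLpNorm_congr_ae hf]
  rw [Lp.norm_toLp, ENNReal.toReal_le_toReal hd.2.ne hk.2.ne] at hle
  have e : ∫⁻ y, ‖h (y + z) - h y‖ₑ ^ 2 = ∫⁻ x, ‖h (z - x) - h (0 - x)‖ₑ ^ 2 := by
    rw [← lintegral_sub_left_eq_self _ (0 : Space n)]
    refine lintegral_congr fun x => ?_
    congr 4
    abel
  rw [e, ← eLpNorm_two_sq, ← eLpNorm_two_sq]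
  gcongr

end Shift

/-! ### Multiplication by a test function maps `H1 O` into `Hs`. -/

section Cutoff

variable {n : ℕ} {s : ℝ} {O : Set (Space n)}

/-! ### Localisation of `H¹(O)` functions -/

theorem H1_norm_sq (w : H1 O) : ‖w‖ ^ 2 = ‖w.1.fst‖ ^ 2 + ‖w.1.snd‖ ^ 2 :=
  WithLp.prod_norm_sq_eq_of_L2 w.1

/-- The product of a cut-off function `φ` and `w`, extended by zero. -/
noncomputable def cutoff (O : Set (Space n)) (φ w : Space n → ℝ) : Space n → ℝ :=
  O.indicator fun x => φ x * w x

/-- The derivative in the direction `z` of `cutoff O φ w`, where `G` is the gradient of `w`. -/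
noncomputable def cutoffDeriv (O : Set (Space n)) (φ w : Space n → ℝ) (G : Space n → Space n)
    (z : Space n) : Space n → ℝ :=
  O.indicator fun x => inner ℝ (G x) z * φ x + w x * fderiv ℝ φ x z

/-- The product `φ ψ` is supported in `O` for every smooth `ψ`, so it may be tested in the weak
gradient of `w`. Thus the extension by zero is weakly differentiable on the whole space. -/
theorem integral_cutoff_mul_fderiv (hO : MeasurableSet O) {φ : Space n → ℝ} (hφ : ContDiff ℝ ∞ φ)
    (hc : HasCompactSupport φ) (hsupp : tsupport φ ⊆ O) (w : H1 O) (z : Space n)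
    {ψ : Space n → ℝ} (hψ : ContDiff ℝ ∞ ψ) :
    ∫ x, cutoff O φ w.1.fst x * fderiv ℝ ψ x z =
      -∫ x, cutoffDeriv O φ w.1.fst w.1.snd z x * ψ x := by
  have e1 : ∀ x, cutoff O φ w.1.fst x * fderiv ℝ ψ x z =
      O.indicator (fun x => w.1.fst x * (φ x * fderiv ℝ ψ x z)) x := by
    intro x
    by_cases hx : x ∈ O
    · simp only [cutoff, indicator_of_mem hx]
      ring
    · simp only [cutoff, indicator_of_notMem hx, zero_mul]
  have e2 : ∀ x, cutoffDeriv O φ w.1.fst w.1.snd z x * ψ x =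
      O.indicator (fun x => inner ℝ (w.1.snd x) z * (φ x * ψ x) +
        w.1.fst x * (fderiv ℝ φ x z * ψ x)) x := by
    intro x
    by_cases hx : x ∈ O
    · simp only [cutoffDeriv, indicator_of_mem hx]
      ring
    · simp only [cutoffDeriv, indicator_of_notMem hx, zero_mul]
  simp only [e1, e2]
  rw [integral_indicator hO, integral_indicator hO]
  obtain ⟨hd, hdc⟩ := test_fderiv hφ hc z
  have hψd : Continuous fun x => fderiv ℝ ψ x z :=
    (hψ.continuous_fderiv (by simp)).clm_apply continuous_const
  have i1 : Integrable (fun x => w.1.fst x * (φ x * fderiv ℝ ψ x z)) (volume.restrict O) :=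
    integrable_mul_of_test _ (hφ.continuous.mul hψd) hc.mul_right
  have i2 : Integrable (fun x => w.1.fst x * (fderiv ℝ φ x z * ψ x)) (volume.restrict O) :=
    integrable_mul_of_test _ (hd.mul hψ.continuous) hdc.mul_right
  have i3 : Integrable (fun x => inner ℝ (w.1.snd x) z * (φ x * ψ x)) (volume.restrict O) :=
    integrable_inner_mul_of_test _ _ (hφ.continuous.mul hψ.continuous) hc.mul_right
  have hw : IsWeakGradient O w.1.fst w.1.snd := w.2
  have key := hw (fun x => φ x * ψ x) (hφ.mul hψ) hc.mul_right
    ((tsupport_mul_subset_left).trans hsupp) z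
  have e3 : ∀ x, fderiv ℝ (fun x => φ x * ψ x) x z = φ x * fderiv ℝ ψ x z + fderiv ℝ φ x z * ψ x := by
    intro x
    rw [fderiv_fun_mul (hφ.differentiable (by simp) x) (hψ.differentiable (by simp) x)]
    simp only [add_apply, smul_apply, smul_eq_mul]
    ring
  simp only [e3, mul_add] at key
  rw [integral_add i1 i2] at key
  rw [integral_add i3 i2]
  linarith

theorem lintegral_enorm_Lp_restrict {E : Type*} [NormedAddCommGroup E] (hO : MeasurableSet O)
    (F : Lp E 2 (volume.restrict O)) :
    ∫⁻ x, O.indicator (fun x => ‖F x‖ₑ ^ 2) x = ENNReal.ofReal (‖F‖ ^ 2) := by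
  rw [lintegral_indicator hO, ← enorm_sq_eq_lintegral, ENNReal.ofReal_pow (norm_nonneg _),
    ofReal_norm]

theorem lintegral_cutoff_le (hO : MeasurableSet O) {φ : Space n → ℝ} {M : ℝ}
    (hM : ∀ x, |φ x| ≤ M) (w : H1 O) :
    ∫⁻ x, ‖cutoff O φ w.1.fst x‖ₑ ^ 2 ≤ ENNReal.ofReal (M ^ 2 * ‖w‖ ^ 2) := by
  have h1 : ∀ x, ‖cutoff O φ w.1.fst x‖ₑ ^ 2 ≤
      ENNReal.ofReal (M ^ 2) * O.indicator (fun x => ‖w.1.fst x‖ₑ ^ 2) x := by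
    intro x
    by_cases hx : x ∈ O
    · simp only [cutoff, indicator_of_mem hx, enorm_sq_eq_ofReal]
      rw [← ENNReal.ofReal_mul (sq_nonneg _), mul_pow, ← sq_abs (φ x)]
      gcongr
      exact hM x
    · simp [cutoff, indicator_of_notMem hx]
  refine (lintegral_mono h1).trans ?_
  rw [lintegral_const_mul' _ _ ENNReal.ofReal_ne_top, lintegral_enorm_Lp_restrict hO,
    ← ENNReal.ofReal_mul (sq_nonneg _)]
  refine ENNReal.ofReal_le_ofReal (mul_le_mul_of_nonneg_left ?_ (sq_nonneg _))
  nlinarith [H1_norm_sq w, sq_nonneg ‖w.1.snd‖]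

theorem lintegral_cutoffDeriv_le (hO : MeasurableSet O) {φ : Space n → ℝ} {M L : ℝ}
    (hM : ∀ x, |φ x| ≤ M) (hL : ∀ x, ‖fderiv ℝ φ x‖ ≤ L) (w : H1 O) (z : Space n) :
    ∫⁻ x, ‖cutoffDeriv O φ w.1.fst w.1.snd z x‖ₑ ^ 2 ≤
      ENNReal.ofReal (2 * (M + L) ^ 2 * ‖w‖ ^ 2 * ‖z‖ ^ 2) := by
  have hM0 : 0 ≤ M := (abs_nonneg _).trans (hM 0)
  have hL0 : 0 ≤ L := (norm_nonneg _).trans (hL 0)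
  have h1 : ∀ x, ‖cutoffDeriv O φ w.1.fst w.1.snd z x‖ₑ ^ 2 ≤
      ENNReal.ofReal (2 * (M + L) ^ 2 * ‖z‖ ^ 2) * (O.indicator (fun x => ‖w.1.fst x‖ₑ ^ 2) x +
        O.indicator (fun x => ‖w.1.snd x‖ₑ ^ 2) x) := by
    intro x
    by_cases hx : x ∈ O
    · simp only [cutoffDeriv, indicator_of_mem hx]
      rw [enorm_sq_eq_ofReal, enorm_sq_eq_ofReal, ← ofReal_norm (w.1.snd x),
        ← ENNReal.ofReal_pow (norm_nonneg _), ← ENNReal.ofReal_add (sq_nonneg _) (sq_nonneg _),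
        ← ENNReal.ofReal_mul (by positivity)]
      refine ENNReal.ofReal_le_ofReal ?_
      have a1 : |inner ℝ (w.1.snd x) z * φ x| ≤ ‖w.1.snd x‖ * ‖z‖ * (M + L) := by
        rw [abs_mul]
        exact mul_le_mul (abs_real_inner_le_norm _ _) ((hM x).trans (by linarith))
          (abs_nonneg _) (by positivity)
      have a2 : |w.1.fst x * fderiv ℝ φ x z| ≤ |w.1.fst x| * (‖z‖ * (M + L)) := by
        rw [abs_mul]
        refine mul_le_mul_of_nonneg_left ?_ (abs_nonneg _)
        refine ((fderiv ℝ φ x).le_opNorm z).trans ?_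
        rw [mul_comm]
        exact mul_le_mul_of_nonneg_left ((hL x).trans (by linarith)) (norm_nonneg _)
      have b1 := pow_le_pow_left₀ (abs_nonneg _) a1 2
      have b2 := pow_le_pow_left₀ (abs_nonneg _) a2 2
      rw [sq_abs, mul_pow, mul_pow] at b1
      rw [sq_abs, mul_pow, mul_pow, sq_abs] at b2
      have b3 := sq_nonneg (inner ℝ (w.1.snd x) z * φ x - w.1.fst x * fderiv ℝ φ x z)
      linarith
    · simp [cutoffDeriv, indicator_of_notMem hx]
  refine (lintegral_mono h1).trans ?_
  have hm : Measurable (O.indicator fun x => ‖w.1.fst x‖ₑ ^ 2) :=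
    ((Lp.stronglyMeasurable w.1.fst).measurable.enorm.pow_const 2).indicator hO
  rw [lintegral_const_mul' _ _ ENNReal.ofReal_ne_top, lintegral_add_left hm,
    lintegral_enorm_Lp_restrict hO, lintegral_enorm_Lp_restrict hO,
    ← ENNReal.ofReal_add (sq_nonneg _) (sq_nonneg _), ← H1_norm_sq,
    ← ENNReal.ofReal_mul (by positivity)]
  refine ENNReal.ofReal_le_ofReal (le_of_eq ?_)
  ring

theorem measurable_cutoff (hO : MeasurableSet O) {φ : Space n → ℝ} (hφ : Continuous φ)
    (w : H1 O) : Measurable (cutoff O φ w.1.fst) :=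
  (hφ.measurable.mul (Lp.stronglyMeasurable w.1.fst).measurable).indicator hO

theorem measurable_cutoffDeriv (hO : MeasurableSet O) {φ : Space n → ℝ} (hφ : ContDiff ℝ ∞ φ)
    (w : H1 O) (z : Space n) : Measurable (cutoffDeriv O φ w.1.fst w.1.snd z) := by
  have h1 : Measurable fun x => inner ℝ (w.1.snd x) z :=
    (Lp.stronglyMeasurable w.1.snd).measurable.inner measurable_const
  have h2 : Measurable fun x => fderiv ℝ φ x z :=
    ((hφ.continuous_fderiv (by simp)).clm_apply continuous_const).measurable
  exact ((h1.mul hφ.continuous.measurable).add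
    ((Lp.stronglyMeasurable w.1.fst).measurable.mul h2)).indicator hO

theorem exists_bounds_of_test {φ : Space n → ℝ} (hφ : ContDiff ℝ ∞ φ) (hc : HasCompactSupport φ) :
    ∃ M L : ℝ, (∀ x, |φ x| ≤ M) ∧ ∀ x, ‖fderiv ℝ φ x‖ ≤ L := by
  obtain ⟨M, hM⟩ := hc.exists_bound_of_continuous hφ.continuous
  obtain ⟨L, hL⟩ := (hc.fderiv ℝ).exists_bound_of_continuous (hφ.continuous_fderiv (by simp))
  exact ⟨M, L, hM, hL⟩

/-- Short translations are controlled by the weak derivative, long ones by the triangle inequality;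
the constant 4 covers both. -/
theorem lintegral_shift_cutoff_le (hO : MeasurableSet O) {φ : Space n → ℝ} (hφ : ContDiff ℝ ∞ φ)
    (hc : HasCompactSupport φ) (hsupp : tsupport φ ⊆ O) {M L : ℝ} (hM : ∀ x, |φ x| ≤ M)
    (hL : ∀ x, ‖fderiv ℝ φ x‖ ≤ L) (w : H1 O) (z : Space n) :
    ∫⁻ y, ‖cutoff O φ w.1.fst (y + z) - cutoff O φ w.1.fst y‖ₑ ^ 2 ≤
      ENNReal.ofReal (4 * (M + L) ^ 2 * ‖w‖ ^ 2 * min (‖z‖ ^ 2) 1) := by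
  have hM0 : 0 ≤ M := (abs_nonneg _).trans (hM 0)
  have hL0 : 0 ≤ L := (norm_nonneg _).trans (hL 0)
  have hm := measurable_cutoff hO hφ.continuous w
  have hmem : MemLp (cutoff O φ w.1.fst) 2 := memLp_two_of_lintegral_lt_top
    hm.aestronglyMeasurable ((lintegral_cutoff_le hO hM w).trans_lt ENNReal.ofReal_lt_top)
  have hmem' : MemLp (cutoffDeriv O φ w.1.fst w.1.snd z) 2 := memLp_two_of_lintegral_lt_top
    (measurable_cutoffDeriv hO hφ w z).aestronglyMeasurable
    ((lintegral_cutoffDeriv_le hO hM hL w z).trans_lt ENNReal.ofReal_lt_top)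
  rcases min_cases (‖z‖ ^ 2) 1 with h | h
  · rw [h.1]
    refine (lintegral_shift_sub_le hmem hmem' fun ψ hψ _ =>
      integral_cutoff_mul_fderiv hO hφ hc hsupp w z hψ).trans
      ((lintegral_cutoffDeriv_le hO hM hL w z).trans (ENNReal.ofReal_le_ofReal ?_))
    gcongr
    norm_num
  · rw [h.1]
    have hb : ∀ y, ‖cutoff O φ w.1.fst (y + z) - cutoff O φ w.1.fst y‖ₑ ^ 2 ≤
        ENNReal.ofReal 2 * (‖cutoff O φ w.1.fst (y + z)‖ₑ ^ 2 + ‖cutoff O φ w.1.fst y‖ₑ ^ 2) := by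
      intro y
      rw [enorm_sq_eq_ofReal, enorm_sq_eq_ofReal, enorm_sq_eq_ofReal,
        ← ENNReal.ofReal_add (sq_nonneg _) (sq_nonneg _), ← ENNReal.ofReal_mul (by norm_num)]
      refine ENNReal.ofReal_le_ofReal ?_
      nlinarith [sq_nonneg (cutoff O φ w.1.fst (y + z) + cutoff O φ w.1.fst y)]
    refine (lintegral_mono hb).trans ?_
    rw [lintegral_const_mul' _ _ ENNReal.ofReal_ne_top,
      lintegral_add_right _ (hm.enorm.pow_const 2),
      lintegral_add_right_eq_self (fun y => ‖cutoff O φ w.1.fst y‖ₑ ^ 2) z]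
    refine (mul_le_mul_right (add_le_add (lintegral_cutoff_le hO hM w)
      (lintegral_cutoff_le hO hM w)) _).trans ?_
    rw [← ENNReal.ofReal_add (by positivity) (by positivity), ← ENNReal.ofReal_mul (by norm_num)]
    refine ENNReal.ofReal_le_ofReal ?_
    have h3 : M ^ 2 * ‖w‖ ^ 2 ≤ (M + L) ^ 2 * ‖w‖ ^ 2 := by
      gcongr
      linarith
    linarith

theorem exists_cutoff_Hs (hn : 1 ≤ n) (hs0 : 0 < s) (hs1 : s < 1) (hO : MeasurableSet O)
    {φ : Space n → ℝ} (hφ : ContDiff ℝ ∞ φ) (hc : HasCompactSupport φ) (hsupp : tsupport φ ⊆ O) :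
    ∃ C : ℝ, ∀ w : H1 O, ∃ v : Hs n s, Hsfn v =ᵐ[volume] cutoff O φ w.1.fst ∧
      ‖v‖ ≤ C * ‖w‖ := by
  obtain ⟨M, L, hM, hL⟩ := exists_bounds_of_test hφ hc
  have hM0 : 0 ≤ M := (abs_nonneg _).trans (hM 0)
  have hL0 : 0 ≤ L := (norm_nonneg _).trans (hL 0)
  set J : ℝ := (∫⁻ z : Space n, ENNReal.ofReal (truncKernel n s z)).toReal with hJ
  have hJ0 : 0 ≤ J := ENNReal.toReal_nonneg
  have hJe : ∫⁻ z : Space n, ENNReal.ofReal (truncKernel n s z) = ENNReal.ofReal J :=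
    (ENNReal.ofReal_toReal (lintegral_truncKernel_lt_top hn hs0 hs1).ne).symm
  -- The L² part contributes `M`; the seminorm contributes the square root of `4 (M + L)² J`.
  refine ⟨M + 2 * (M + L) * √J, fun w => ?_⟩
  have hm := measurable_cutoff hO hφ.continuous w
  have h1 := lintegral_cutoff_le hO hM w
  have h2 := lintegral_diffQuot_le_of_shift hs0 hm (by positivity)
    (lintegral_shift_cutoff_le hO hφ hc hsupp hM hL w)
  rw [hJe, ← ENNReal.ofReal_mul (by positivity)] at h2
  obtain ⟨v, hv⟩ := exists_Hs_of_memLp (s := s)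
    (memLp_two_of_lintegral_lt_top hm.aestronglyMeasurable (h1.trans_lt ENNReal.ofReal_lt_top))
    (memLp_two_of_lintegral_lt_top (measurable_diffQuot hm.aestronglyMeasurable)
      (h2.trans_lt ENNReal.ofReal_lt_top))
  refine ⟨v, hv, (Hs_norm_le (a := M * ‖w‖) (b := 2 * (M + L) * √J * ‖w‖) hv (by positivity)
    (by positivity) ?_ ?_).trans_eq (by ring)⟩
  · rwa [mul_pow]
  · refine h2.trans_eq ?_
    congr 1
    rw [mul_pow, mul_pow, mul_pow, Real.sq_sqrt hJ0]
    ring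

theorem ae_restrict_imp (hO : MeasurableSet O) {P : Space n → Prop}
    (h : ∀ᵐ x ∂(volume.restrict O), P x) : ∀ᵐ x, x ∈ O → P x :=
  (ae_restrict_iff' hO).1 h

theorem Hsfn_add_ae (u v : Hs n s) :
    Hsfn (u + v) =ᵐ[volume] fun x => Hsfn u x + Hsfn v x :=
  Lp.coeFn_add (Hsfn u) (Hsfn v)

theorem Hsfn_smul_ae (c : ℝ) (u : Hs n s) :
    Hsfn (c • u) =ᵐ[volume] fun x => c * Hsfn u x :=
  Lp.coeFn_smul c (Hsfn u)

theorem Hs_ext_ae {u v : Hs n s} (h : Hsfn u =ᵐ[volume] Hsfn v) : u = v := Hs_ext (Lp.ext h)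

theorem cutoff_add_ae (hO : MeasurableSet O) (φ : Space n → ℝ)
    (v w : Lp ℝ 2 (volume.restrict O)) : cutoff O φ (v + w : Lp ℝ 2 (volume.restrict O)) =ᵐ[volume]
      fun x => cutoff O φ v x + cutoff O φ w x := by
  filter_upwards [ae_restrict_imp hO (Lp.coeFn_add v w)] with x h
  by_cases hx : x ∈ O
  · simp only [cutoff, indicator_of_mem hx]
    rw [h hx, Pi.add_apply, mul_add]
  · simp only [cutoff, indicator_of_notMem hx, add_zero]

theorem cutoff_smul_ae (hO : MeasurableSet O) (φ : Space n → ℝ) (c : ℝ)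
    (w : Lp ℝ 2 (volume.restrict O)) : cutoff O φ (c • w : Lp ℝ 2 (volume.restrict O)) =ᵐ[volume]
      fun x => c * cutoff O φ w x := by
  filter_upwards [ae_restrict_imp hO (Lp.coeFn_smul c w)] with x h
  by_cases hx : x ∈ O
  · simp only [cutoff, indicator_of_mem hx]
    rw [h hx, Pi.smul_apply, smul_eq_mul, mul_left_comm]
  · simp only [cutoff, indicator_of_notMem hx, mul_zero]

theorem exists_clm_of_bound {X Y : Type*} [NormedAddCommGroup X] [NormedSpace ℝ X]
    [NormedAddCommGroup Y] [NormedSpace ℝ Y] {P : X → Y} (hadd : ∀ v w, P (v + w) = P v + P w)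
    (hsmul : ∀ (c : ℝ) w, P (c • w) = c • P w) {C : ℝ} (hC : ∀ w, ‖P w‖ ≤ C * ‖w‖) :
    ∃ M : X →L[ℝ] Y, ∀ w, M w = P w :=
  ⟨LinearMap.mkContinuous ⟨⟨P, hadd⟩, hsmul⟩ C hC, fun _ => rfl⟩

set_option maxHeartbeats 800000 in
/-- Multiplication by a cut-off function `φ ∈ C_c^∞(O)` as an operator `H¹(O) → Hˢ(ℝⁿ)`. -/
theorem exists_cutoff_operator (hn : 1 ≤ n) (hs0 : 0 < s) (hs1 : s < 1) (hO : MeasurableSet O)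
    {φ : Space n → ℝ} (hφ : ContDiff ℝ ∞ φ) (hc : HasCompactSupport φ) (hsupp : tsupport φ ⊆ O) :
    ∃ M : H1 O →L[ℝ] Hs n s, ∀ w, Hsfn (M w) =ᵐ[volume] cutoff O φ (H1fn w) := by
  obtain ⟨C, hC⟩ := exists_cutoff_Hs (s := s) hn hs0 hs1 hO hφ hc hsupp
  choose P hP hPn using hC
  -- The images are chosen one at a time, but an element of `Hs` is determined by its a.e. class, so
  -- the choice is linear.
  have hadd : ∀ v w, P (v + w) = P v + P w := fun v w => by
    refine Hs_ext_ae ?_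
    filter_upwards [hP (v + w), hP v, hP w, Hsfn_add_ae (P v) (P w),
      cutoff_add_ae hO φ v.1.fst w.1.fst] with x h1 h2 h3 h4 h5
    rw [h4, h2, h3, ← h5, h1]
    rfl
  have hsmul : ∀ (c : ℝ) w, P (c • w) = c • P w := fun c w => by
    refine Hs_ext_ae ?_
    filter_upwards [hP (c • w), hP w, Hsfn_smul_ae c (P w),
      cutoff_smul_ae hO φ c w.1.fst] with x h1 h2 h4 h5
    rw [h4, h2, ← h5, h1]
    rfl
  obtain ⟨M, hM⟩ := exists_clm_of_bound hadd hsmul hPn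
  exact ⟨M, fun w => by rw [hM]; exact hP w⟩

/-- Test functions belong to the closure of the functions vanishing on the holes. -/
theorem mem_perforatedClosure_of_test (hn : 1 ≤ n) (hs0 : 0 < s) (hs1 : s < 1)
    (hO : IsBoundedLipschitzDomain O) {T : ℝ → Set (Space n)} {w : ℝ → H1 O}
    (hw_holes : ∀ ε > 0, ∀ᵐ x ∂(volume.restrict O), x ∈ holes T ε → H1fn (w ε) x = 0)
    (hw_weak : WeaklyTendsto w (𝓝[>] 0) (H1.one hO.isBounded))
    {φ : Space n → ℝ} (hφ : ContDiff ℝ ∞ φ) (hc : HasCompactSupport φ) (hsupp : tsupport φ ⊆ O)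
    {v : Hs n s} (hv : Hsfn v =ᵐ[volume] φ) : v ∈ perforatedClosure s O T := by
  have hOm := hO.isOpen.measurableSet
  obtain ⟨M, hM⟩ := exists_cutoff_operator (s := s) hn hs0 hs1 hOm hφ hc hsupp
  -- `M (w ε)` is `φ w_ε`, which vanishes off the perforated domain; its weak limit is `φ` times 1.
  have hmem : M (H1.one hO.isBounded) ∈ perforatedClosure s O T := by
    refine hw_weak.map_mem M (isClosed_perforatedClosure O T) ?_
    filter_upwards [self_mem_nhdsWithin] with ε hε
    refine HsTilde_le_perforatedClosure O T hε ?_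
    change ∀ᵐ x, x ∉ perforated O T ε → Hsfn (M (w ε)) x = 0
    filter_upwards [hM (w ε), ae_restrict_imp hOm (hw_holes ε hε)] with x h1 h2 hx
    rw [h1]
    by_cases hxO : x ∈ O
    · have hxT : x ∈ holes T ε := by
        by_contra hxT
        exact hx ⟨hxO, hxT⟩
      rw [cutoff, indicator_of_mem hxO, h2 hxO hxT, mul_zero]
    · rw [cutoff, indicator_of_notMem hxO]
  convert hmem
  refine Hs_ext (Lp.ext ?_)
  filter_upwards [hv, hM (H1.one hO.isBounded), ae_restrict_imp hOm (oneL2_ae hO.isBounded)]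
    with x h1 h2 h3
  rw [h1, h2]
  by_cases hxO : x ∈ O
  · have h4 : H1fn (H1.one hO.isBounded) x = 1 := h3 hxO
    rw [cutoff, indicator_of_mem hxO, h4, mul_one]
  · rw [cutoff, indicator_of_notMem hxO]
    exact image_eq_zero_of_notMem_tsupport fun h => hxO (hsupp h)

end Cutoff

/-! ### Mollification as averaging over translations. -/

section Average

variable {n : ℕ} {s : ℝ}

/-! ### Averages of translates -/

theorem enorm_integral_sq_le {α : Type*} [MeasurableSpace α] {ν : Measure α}
    [IsProbabilityMeasure ν] {f : α → ℝ} (hf : AEStronglyMeasurable f ν) :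
    ‖∫ x, f x ∂ν‖ₑ ^ 2 ≤ ∫⁻ x, ‖f x‖ₑ ^ 2 ∂ν := by
  rw [← eLpNorm_two_sq]
  refine pow_le_pow_left' ?_ 2
  refine (enorm_integral_le_lintegral_enorm f).trans ?_
  rw [← eLpNorm_one_eq_lintegral_enorm]
  exact eLpNorm_le_eLpNorm_of_exponent_le one_le_two hf

/-- The average of the translates of `u` with respect to the measure `ν`. -/
noncomputable def average (ν : Measure (Space n)) (u : Space n → ℝ) (x : Space n) : ℝ :=
  ∫ y, u (x - y) ∂ν

theorem measurable_average {ν : Measure (Space n)} [IsProbabilityMeasure ν] {u : Space n → ℝ}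
    (hu : Measurable u) : Measurable (average ν u) := by
  have h : StronglyMeasurable fun p : Space n × Space n => u (p.1 - p.2) :=
    (hu.comp (measurable_fst.sub measurable_snd)).stronglyMeasurable
  exact h.integral_prod_right.measurable

theorem lintegral_lintegral_shift {ν : Measure (Space n)} [IsProbabilityMeasure ν]
    {u : Space n → ℝ} (hu : Measurable u) :
    ∫⁻ x, ∫⁻ y, ‖u (x - y)‖ₑ ^ 2 ∂ν = ∫⁻ x, ‖u x‖ₑ ^ 2 := by
  have hm : Measurable fun p : Space n × Space n => ‖u (p.1 - p.2)‖ₑ ^ 2 := by fun_prop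
  rw [lintegral_lintegral_swap hm.aemeasurable]
  simp only [lintegral_sub_right_eq_self (fun x => ‖u x‖ₑ ^ 2), lintegral_const, measure_univ,
    mul_one]

theorem lintegral_average_le {ν : Measure (Space n)} [IsProbabilityMeasure ν] {u : Space n → ℝ}
    (hu : Measurable u) : ∫⁻ x, ‖average ν u x‖ₑ ^ 2 ≤ ∫⁻ x, ‖u x‖ₑ ^ 2 := by
  rw [← lintegral_lintegral_shift (ν := ν) hu]
  refine lintegral_mono fun x => enorm_integral_sq_le ?_
  exact (hu.comp (measurable_const.sub measurable_id)).aestronglyMeasurable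

theorem ae_integrable_shift {ν : Measure (Space n)} [IsProbabilityMeasure ν] {u : Space n → ℝ}
    (hu : Measurable u) (hu2 : ∫⁻ x, ‖u x‖ₑ ^ 2 < ⊤) :
    ∀ᵐ x, Integrable (fun y => u (x - y)) ν := by
  have hm : Measurable fun p : Space n × Space n => ‖u (p.1 - p.2)‖ₑ ^ 2 := by fun_prop
  rw [← lintegral_lintegral_shift (ν := ν) hu] at hu2
  filter_upwards [ae_lt_top hm.lintegral_prod_right' hu2.ne] with x hx
  have hxm : AEStronglyMeasurable (fun y => u (x - y)) ν :=
    (hu.comp (measurable_const.sub measurable_id)).aestronglyMeasurable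
  exact (memLp_two_of_lintegral_lt_top hxm hx).integrable one_le_two

/-- The kernel is invariant under diagonal translations, so the difference quotient commutes with
averaging; Jensen and translation invariance do the rest. -/
theorem lintegral_diffQuot_average_le {ν : Measure (Space n)} [IsProbabilityMeasure ν]
    {u : Space n → ℝ} (hu : Measurable u) (hu2 : ∫⁻ x, ‖u x‖ₑ ^ 2 < ⊤) :
    ∫⁻ p, ‖diffQuot s (average ν u) p‖ₑ ^ 2 ≤ ∫⁻ p, ‖diffQuot s u p‖ₑ ^ 2 := by
  have hq : Measurable (diffQuot s u) := by
    unfold diffQuot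
    fun_prop
  have hm : Measurable fun q : (Space n × Space n) × Space n =>
      ‖diffQuot s u (q.1 - (q.2, q.2))‖ₑ ^ 2 :=
    (hq.comp (measurable_fst.sub (measurable_snd.prodMk measurable_snd))).enorm.pow_const 2
  calc ∫⁻ p, ‖diffQuot s (average ν u) p‖ₑ ^ 2
      ≤ ∫⁻ p, ∫⁻ y, ‖diffQuot s u (p - (y, y))‖ₑ ^ 2 ∂ν := by
        refine lintegral_mono_ae ?_
        filter_upwards [ae_prod_of_ae (ae_integrable_shift (ν := ν) hu hu2)] with p hp
        have e : diffQuot s (average ν u) p = ∫ y, diffQuot s u (p - (y, y)) ∂ν := by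
          simp only [diffQuot, average, Prod.fst_sub, Prod.snd_sub, sub_sub_sub_cancel_right]
          rw [integral_div, integral_sub hp.1 hp.2]
        rw [e]
        refine enorm_integral_sq_le ?_
        exact (hq.comp (measurable_const.sub
          (measurable_id.prodMk measurable_id))).aestronglyMeasurable
    _ = ∫⁻ y, (∫⁻ p, ‖diffQuot s u (p - (y, y))‖ₑ ^ 2) ∂ν := by
        rw [lintegral_lintegral_swap hm.aemeasurable]
    _ = _ := by
        have e : ∀ y : Space n, ∫⁻ p, ‖diffQuot s u (p - (y, y))‖ₑ ^ 2 =
            ∫⁻ p, ‖diffQuot s u p‖ₑ ^ 2 := fun y => by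
          rw [Measure.volume_eq_prod]
          exact lintegral_sub_right_eq_self (μ := (volume : Measure (Space n)).prod volume)
            (fun p => ‖diffQuot s u p‖ₑ ^ 2) (y, y)
        simp only [e, lintegral_const, measure_univ, mul_one]

theorem lintegral_average_sub_le {ν : Measure (Space n)} [IsProbabilityMeasure ν]
    {u : Space n → ℝ} (hu : Measurable u) (hu2 : ∫⁻ x, ‖u x‖ₑ ^ 2 < ⊤) {δ : ℝ≥0∞}
    (h : ∀ᵐ y ∂ν, ∫⁻ x, ‖u (x - y) - u x‖ₑ ^ 2 ≤ δ) :
    ∫⁻ x, ‖average ν u x - u x‖ₑ ^ 2 ≤ δ := by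
  have hm : Measurable fun p : Space n × Space n => ‖u (p.1 - p.2) - u p.1‖ₑ ^ 2 := by fun_prop
  calc ∫⁻ x, ‖average ν u x - u x‖ₑ ^ 2
      ≤ ∫⁻ x, ∫⁻ y, ‖u (x - y) - u x‖ₑ ^ 2 ∂ν := by
        refine lintegral_mono_ae ?_
        filter_upwards [ae_integrable_shift (ν := ν) hu hu2] with x hx
        have e : average ν u x - u x = ∫ y, (u (x - y) - u x) ∂ν := by
          rw [integral_sub hx (integrable_const _)]
          simp [average]
        rw [e]
        refine enorm_integral_sq_le ?_
        exact ((hu.comp (measurable_const.sub measurable_id)).sub_const _).aestronglyMeasurable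
    _ = ∫⁻ y, (∫⁻ x, ‖u (x - y) - u x‖ₑ ^ 2) ∂ν := by
        rw [lintegral_lintegral_swap hm.aemeasurable]
    _ ≤ ∫⁻ _, δ ∂ν := lintegral_mono_ae h
    _ = δ := by simp

/-- Translations are continuous in `L²`. -/
theorem eventually_lintegral_shift_sub_le (F : Lp ℝ 2 (volume : Measure (Space n))) {δ : ℝ}
    (hδ : 0 < δ) : ∀ᶠ y in 𝓝 (0 : Space n),
      ∫⁻ x, ‖F (x - y) - F x‖ₑ ^ 2 ≤ ENNReal.ofReal (δ ^ 2) := by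
  have : Fact ((2 : ℝ≥0∞) ≠ ⊤) := ⟨by simp⟩
  have hcont : Continuous fun y : Space n => DomAddAct.mk (-y) +ᵥ F :=
    (DomAddAct.continuous_mk.comp continuous_neg).vadd continuous_const
  have h0 := (Metric.tendsto_nhds.1 (hcont.tendsto 0)) δ hδ
  filter_upwards [h0] with y hy
  have e0 : DomAddAct.mk (-(0 : Space n)) +ᵥ F = F := by simp
  rw [e0, dist_eq_norm] at hy
  have e : ∫⁻ x, ‖F (x - y) - F x‖ₑ ^ 2 = ‖(DomAddAct.mk (-y) +ᵥ F) - F‖ₑ ^ 2 := by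
    rw [enorm_sq_eq_lintegral]
    refine lintegral_congr_ae ?_
    filter_upwards [Lp.coeFn_sub (DomAddAct.mk (-y) +ᵥ F) F,
      DomAddAct.vadd_Lp_ae_eq (DomAddAct.mk (-y)) F] with x h1 h2
    rw [h1, Pi.sub_apply, h2]
    simp [sub_eq_neg_add]
  rw [e, ← ofReal_norm, ← ENNReal.ofReal_pow (norm_nonneg _)]
  gcongr

theorem exists_average_Hs (ν : Measure (Space n)) [IsProbabilityMeasure ν] (u : Hs n s) :
    ∃ v : Hs n s, Hsfn v =ᵐ[volume] average ν (Hsfn u) ∧ ‖v‖ ≤ 2 * ‖u‖ := by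
  have hum := (Lp.stronglyMeasurable (Hsfn u)).measurable
  have h0 := Hsfn_lintegral_le u
  have h1 := (lintegral_average_le (ν := ν) hum).trans h0
  have h2 := (lintegral_diffQuot_average_le (ν := ν) (s := s) hum
    (h0.trans_lt ENNReal.ofReal_lt_top)).trans (diffQuot_lintegral_le u)
  have hm := measurable_average (ν := ν) hum
  obtain ⟨v, hv⟩ := exists_Hs_of_memLp (s := s)
    (memLp_two_of_lintegral_lt_top hm.aestronglyMeasurable (h1.trans_lt ENNReal.ofReal_lt_top))
    (memLp_two_of_lintegral_lt_top (measurable_diffQuot hm.aestronglyMeasurable)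
      (h2.trans_lt ENNReal.ofReal_lt_top))
  exact ⟨v, hv, (Hs_norm_le hv (norm_nonneg u) (norm_nonneg u) h1 h2).trans_eq (by ring)⟩

/-- A closed subspace of `Hˢ(ℝⁿ)` contains `u` if it contains the averages of `u` with respect to
probability measures concentrating at the origin. -/
theorem mem_of_average_mem {W : Submodule ℝ (Hs n s)} (hW : IsClosed (W : Set (Hs n s)))
    {u : Hs n s} {ν : ℕ → Measure (Space n)} [∀ k, IsProbabilityMeasure (ν k)]
    (hν : ∀ U ∈ 𝓝 (0 : Space n), ∀ᶠ k in atTop, ∀ᵐ y ∂(ν k), y ∈ U)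
    (h : ∀ k, ∀ v : Hs n s, Hsfn v =ᵐ[volume] average (ν k) (Hsfn u) → v ∈ W) : u ∈ W := by
  choose v hv hvn using fun k => exists_average_Hs (ν k) u
  have hum := (Lp.stronglyMeasurable (Hsfn u)).measurable
  -- The averages are bounded in `Hs` by `2 ‖u‖`, so L² convergence alone suffices.
  refine mem_of_tendsto_of_bounded HsfnL_injective hW (fun k => h k _ (hv k)) hvn ?_
  refine Metric.tendsto_nhds.2 fun δ hδ => ?_
  filter_upwards [hν _ (eventually_lintegral_shift_sub_le (Hsfn u) (half_pos hδ))] with k hk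
  have h1 := lintegral_average_sub_le hum
    ((Hsfn_lintegral_le u).trans_lt ENNReal.ofReal_lt_top) hk
  have e : ‖Hsfn (v k) - Hsfn u‖ₑ ^ 2 = ∫⁻ x, ‖average (ν k) (Hsfn u) x - Hsfn u x‖ₑ ^ 2 := by
    rw [enorm_sq_eq_lintegral]
    refine lintegral_congr_ae ?_
    filter_upwards [Lp.coeFn_sub (Hsfn (v k)) (Hsfn u), hv k] with x h1 h2
    rw [h1, Pi.sub_apply, h2]
  rw [← e, ← ofReal_norm, ← ENNReal.ofReal_pow (norm_nonneg _),
    ENNReal.ofReal_le_ofReal_iff (by positivity)] at h1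
  rw [dist_eq_norm]
  change ‖Hsfn (v k) - Hsfn u‖ < δ
  have := abs_le_of_sq_le_sq' h1 (by positivity) |>.2
  linarith

/-- The probability measure with density a normed bump function. -/
noncomputable def bumpMeasure {c : Space n} (ρ : ContDiffBump c) : Measure (Space n) :=
  volume.withDensity fun y => ENNReal.ofReal (ρ.normed volume y)

instance {c : Space n} (ρ : ContDiffBump c) : IsProbabilityMeasure (bumpMeasure ρ) := by
  refine ⟨?_⟩
  rw [bumpMeasure, withDensity_apply _ MeasurableSet.univ, Measure.restrict_univ,
    ← ofReal_integral_eq_lintegral_ofReal ρ.integrable_normed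
      (Eventually.of_forall ρ.nonneg_normed), ρ.integral_normed, ENNReal.ofReal_one]

theorem ae_bumpMeasure {c : Space n} (ρ : ContDiffBump c) :
    ∀ᵐ y ∂(bumpMeasure ρ), y ∈ Metric.ball c ρ.rOut := by
  rw [bumpMeasure, ae_withDensity_iff ρ.continuous_normed.measurable.ennreal_ofReal]
  refine Eventually.of_forall fun y hy => ?_
  rw [← ρ.support_normed_eq (μ := volume)]
  intro h0
  exact hy (by rw [h0, ENNReal.ofReal_zero])

theorem average_bumpMeasure {c : Space n} (ρ : ContDiffBump c) (u : Space n → ℝ) :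
    average (bumpMeasure ρ) u = ρ.normed volume ⋆[ContinuousLinearMap.mul ℝ ℝ, volume] u := by
  ext x
  rw [average, bumpMeasure, integral_withDensity_eq_integral_toReal_smul
    ρ.continuous_normed.measurable.ennreal_ofReal (Eventually.of_forall fun _ => by finiteness)]
  rw [convolution_def]
  refine integral_congr_ae (Eventually.of_forall fun y => ?_)
  simp [ENNReal.toReal_ofReal (ρ.nonneg_normed y)]

theorem contDiff_average_bumpMeasure {c : Space n} (ρ : ContDiffBump c)
    (u : Lp ℝ 2 (volume : Measure (Space n))) : ContDiff ℝ ∞ (average (bumpMeasure ρ) u) := by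
  rw [average_bumpMeasure]
  exact ρ.hasCompactSupport_normed.contDiff_convolution_left _ ρ.contDiff_normed
    ((Lp.memLp u).locallyIntegrable one_le_two)

/-- The average of a function vanishing outside `A` vanishes outside `A + ball c r`. -/
theorem average_bumpMeasure_eq_zero {c : Space n} (ρ : ContDiffBump c) {u : Space n → ℝ}
    {A : Set (Space n)} (hu : ∀ᵐ x, x ∉ A → u x = 0) {x : Space n}
    (hx : ∀ y ∈ Metric.ball c ρ.rOut, x - y ∉ A) : average (bumpMeasure ρ) u x = 0 := by
  refine integral_eq_zero_of_ae ?_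
  have h1 : ∀ᵐ y, x - y ∉ A → u (x - y) = 0 :=
    (Measure.measurePreserving_sub_left volume x).quasiMeasurePreserving.ae hu
  have h2 : ∀ᵐ y ∂(bumpMeasure ρ), x - y ∉ A → u (x - y) = 0 :=
    (withDensity_absolutelyContinuous _ _).ae_le h1
  filter_upwards [h2, ae_bumpMeasure ρ] with y hy1 hy2
  exact hy1 (hx y hy2)

end Average

/-! ### Test functions are dense in `HsTilde s O` for Lipschitz `O`. -/

section Density

variable {n : ℕ} {s : ℝ} {O : Set (Space n)}

/-! ### Density of test functions -/

/-- `W` contains the test functions in `O`. -/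
def ContainsTest (O : Set (Space n)) (W : Submodule ℝ (Hs n s)) : Prop :=
  ∀ φ : Space n → ℝ, ContDiff ℝ ∞ φ → HasCompactSupport φ → tsupport φ ⊆ O →
    ∀ v : Hs n s, Hsfn v =ᵐ[volume] φ → v ∈ W

/-- Bumps centred at `c k` rather than 0 translate while they mollify. If this carries `A` into a
compact subset of `O`, the averages are test functions in `O`, and they approach `u` as the bumps
concentrate at 0. -/
theorem mem_of_bumps {W : Submodule ℝ (Hs n s)} (hW : IsClosed (W : Set (Hs n s)))
    (hWt : ContainsTest O W) {A : Set (Space n)} {c : ℕ → Space n} (ρ : ∀ k, ContDiffBump (c k))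
    (hc : Tendsto c atTop (𝓝 0)) (hρ : Tendsto (fun k => (ρ k).rOut) atTop (𝓝 0))
    {K : ℕ → Set (Space n)} (hK : ∀ k, IsCompact (K k)) (hKO : ∀ k, K k ⊆ O)
    (hA : ∀ k, ∀ p ∈ A, ∀ y ∈ Metric.ball (c k) (ρ k).rOut, p + y ∈ K k) {u : Hs n s}
    (hu : ∀ᵐ x, x ∉ A → Hsfn u x = 0) : u ∈ W := by
  refine mem_of_average_mem hW (ν := fun k => bumpMeasure (ρ k)) ?_ fun k v hv => ?_
  · intro U hU
    obtain ⟨δ, hδ, hδU⟩ := Metric.mem_nhds_iff.1 hU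
    filter_upwards [Metric.tendsto_nhds.1 hc _ (half_pos hδ), hρ.eventually_lt_const (half_pos hδ)]
      with k h1 h2
    filter_upwards [ae_bumpMeasure (ρ k)] with y hy
    refine hδU (Metric.mem_ball.2 ((dist_triangle y (c k) 0).trans_lt ?_))
    have := Metric.mem_ball.1 hy
    linarith
  · have hsub : Function.support (average (bumpMeasure (ρ k)) (Hsfn u)) ⊆ K k := by
      intro x hx
      by_contra hxK
      refine hx (average_bumpMeasure_eq_zero (ρ k) hu fun y hy hxy => hxK ?_)
      have := hA k _ hxy y hy
      rwa [sub_add_cancel] at this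
    have hts : tsupport (average (bumpMeasure (ρ k)) (Hsfn u)) ⊆ K k :=
      closure_minimal hsub (hK k).isClosed
    exact hWt _ (contDiff_average_bumpMeasure _ _)
      ((hK k).of_isClosed_subset (isClosed_tsupport _) hts) (hts.trans (hKO k)) v hv

theorem tendsto_const_div_succ (a : ℝ) : Tendsto (fun k : ℕ => a / ((k : ℝ) + 1)) atTop (𝓝 0) :=
  tendsto_const_nhds.div_atTop
    (tendsto_atTop_add_const_right _ _ tendsto_natCast_atTop_atTop)

theorem exists_radius_of_mem {W : Submodule ℝ (Hs n s)} (hW : IsClosed (W : Set (Hs n s)))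
    (hWt : ContainsTest O W) (hO : IsOpen O) {x₀ : Space n} (hx₀ : x₀ ∈ O) :
    ∃ r > 0, ∀ u : Hs n s, (∀ᵐ x, x ∉ O ∩ Metric.ball x₀ r → Hsfn u x = 0) → u ∈ W := by
  obtain ⟨R, hR, hRO⟩ := Metric.nhds_basis_closedBall.mem_iff.1 (hO.mem_nhds hx₀)
  refine ⟨R / 2, half_pos hR, fun u hu => ?_⟩
  have hpos : ∀ k : ℕ, 0 < R / 2 / ((k : ℝ) + 1) := fun k => by positivity
  refine mem_of_bumps hW hWt (c := fun _ => 0)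
    (fun k => ⟨R / 2 / ((k : ℝ) + 1) / 2, R / 2 / ((k : ℝ) + 1), half_pos (hpos k),
      half_lt_self (hpos k)⟩) tendsto_const_nhds (tendsto_const_div_succ _)
    (K := fun _ => Metric.closedBall x₀ R) (fun _ => isCompact_closedBall _ _) (fun _ => hRO)
    (fun k p hp y hy => ?_) hu
  have h1 : ‖p - x₀‖ < R / 2 := by rw [← dist_eq_norm]; exact hp.2
  have h2 : ‖y‖ < R / 2 / ((k : ℝ) + 1) := mem_ball_zero_iff.1 hy
  have h3 : R / 2 / ((k : ℝ) + 1) ≤ R / 2 :=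
    div_le_self (half_pos hR).le (by linarith [(Nat.cast_nonneg k : (0 : ℝ) ≤ k)])
  rw [Metric.mem_closedBall, dist_eq_norm, add_sub_right_comm]
  exact (norm_add_le _ _).trans (by linarith)

/-- Write `y = t ν + e`. Moving by `t ν` raises the point above the graph by `t`; the error `e`
costs at most `(1 + 2K) ‖e‖`, which is below `t / 2` for the given radius. -/
theorem graph_shift_le {ν : Space n} (hν : ‖ν‖ = 1) {K : ℝ≥0} {γ : Space n → ℝ}
    (hγ : LipschitzWith K γ) {t : ℝ} {p y : Space n}
    (hp : γ (p - inner ℝ ν p • ν) < inner ℝ ν p)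
    (hy : ‖y - t • ν‖ < t / (4 * (1 + K))) :
    γ (p + y - inner ℝ ν (p + y) • ν) ≤ inner ℝ ν (p + y) - t / 2 := by
  obtain ⟨e, rfl⟩ : ∃ e, y = t • ν + e := ⟨y - t • ν, by abel⟩
  rw [add_sub_cancel_left] at hy
  have hK0 : (0 : ℝ) ≤ K := K.2
  have hνν : inner ℝ ν ν = (1 : ℝ) := by rw [real_inner_self_eq_norm_sq, hν, one_pow]
  have he : |inner ℝ ν e| ≤ ‖e‖ := by
    have := abs_real_inner_le_norm ν e
    rwa [hν, one_mul] at this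
  have h1 : p + (t • ν + e) - inner ℝ ν (p + (t • ν + e)) • ν =
      (p - inner ℝ ν p • ν) + (e - inner ℝ ν e • ν) := by
    rw [inner_add_right, inner_add_right, inner_smul_right, hνν, mul_one, add_smul, add_smul]
    abel
  have h2 : ‖e - inner ℝ ν e • ν‖ ≤ 2 * ‖e‖ := by
    refine (norm_sub_le _ _).trans ?_
    rw [norm_smul, hν, mul_one, Real.norm_eq_abs]
    linarith
  have h3 := (le_abs_self _).trans (hγ.dist_le_mul
    ((p - inner ℝ ν p • ν) + (e - inner ℝ ν e • ν)) (p - inner ℝ ν p • ν))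
  rw [dist_eq_norm, add_sub_cancel_left] at h3
  have h4 := mul_le_mul_of_nonneg_left h2 hK0
  rw [lt_div_iff₀ (by positivity)] at hy
  rw [h1, inner_add_right, inner_add_right, inner_smul_right, hνν, mul_one]
  have h5 := (abs_le.1 he).1
  have h6 := norm_nonneg e
  nlinarith [mul_nonneg hK0 h6]

set_option maxHeartbeats 800000 in
-- Near the boundary, shift along `ν` into the domain by `t k` and mollify at a scale proportional
-- to `t k`, small enough that the Lipschitz graph is not crossed.
theorem exists_radius_of_mem_frontier {W : Submodule ℝ (Hs n s)}
    (hW : IsClosed (W : Set (Hs n s))) (hWt : ContainsTest O W) (hO : IsBoundedLipschitzDomain O)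
    {x₀ : Space n} (hx₀ : x₀ ∈ frontier O) :
    ∃ r > 0, ∀ u : Hs n s, (∀ᵐ x, x ∉ O ∩ Metric.ball x₀ r → Hsfn u x = 0) → u ∈ W := by
  obtain ⟨ν, hν, R, hR, K, γ, hγ, hloc⟩ := hO.lipschitz_boundary x₀ hx₀
  refine ⟨R / 2, half_pos hR, fun u hu => ?_⟩
  have hK0 : (0 : ℝ) ≤ K := K.2
  -- Shift and mollification move points by at most `2 t k ≤ R / 4`, so the ball of radius `R / 2`
  -- stays within radius `3R / 4`, where the graph description holds.
  set t : ℕ → ℝ := fun k => R / 8 / ((k : ℝ) + 1)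
  have ht0 : ∀ k, 0 < t k := fun k => by positivity
  have ht1 : ∀ k, t k ≤ R / 8 := fun k =>
    div_le_self (by positivity) (by linarith [(Nat.cast_nonneg k : (0 : ℝ) ≤ k)])
  have htt : Tendsto t atTop (𝓝 0) := tendsto_const_div_succ _
  have hr0 : ∀ k, 0 < t k / (4 * (1 + K)) := fun k => div_pos (ht0 k) (by positivity)
  have hcont : Continuous fun x : Space n => γ (x - inner ℝ ν x • ν) :=
    hγ.continuous.comp (by fun_prop)
  refine mem_of_bumps hW hWt (c := fun k => t k • ν)
    (fun k => ⟨t k / (4 * (1 + K)) / 2, t k / (4 * (1 + K)), half_pos (hr0 k),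
      half_lt_self (hr0 k)⟩) ?_ ?_
    (K := fun k => Metric.closedBall x₀ (3 * R / 4) ∩
      {x | γ (x - inner ℝ ν x • ν) ≤ inner ℝ ν x - t k / 2}) (fun k => ?_) (fun k => ?_)
    (fun k p hp y hy => ?_) hu
  · simpa using htt.smul_const ν
  · simpa using htt.div_const (4 * (1 + (K : ℝ)))
  · exact (isCompact_closedBall _ _).inter_right (isClosed_le hcont (by fun_prop))
  · rintro x ⟨hx1, hx2⟩
    have hx2 : γ (x - inner ℝ ν x • ν) ≤ inner ℝ ν x - t k / 2 := hx2
    refine (hloc x (Metric.closedBall_subset_ball (by linarith) hx1)).2 ?_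
    linarith [ht0 k]
  · have hy' : ‖y - t k • ν‖ < t k / (4 * (1 + K)) := by rw [← dist_eq_norm]; exact hy
    have hp1 : γ (p - inner ℝ ν p • ν) < inner ℝ ν p :=
      (hloc p (Metric.ball_subset_ball (by linarith) hp.2)).1 hp.1
    refine ⟨?_, graph_shift_le hν hγ hp1 hy'⟩
    have h1 : ‖p - x₀‖ < R / 2 := by rw [← dist_eq_norm]; exact hp.2
    have h2 : t k / (4 * (1 + K)) ≤ t k := div_le_self (ht0 k).le (by linarith)
    have h3 : ‖y‖ ≤ ‖y - t k • ν‖ + ‖t k • ν‖ := by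
      have := norm_add_le (y - t k • ν) (t k • ν)
      rwa [sub_add_cancel] at this
    rw [norm_smul, hν, mul_one, Real.norm_eq_abs, abs_of_pos (ht0 k)] at h3
    rw [Metric.mem_closedBall, dist_eq_norm, add_sub_right_comm]
    exact (norm_add_le _ _).trans (by linarith [ht1 k])

theorem exists_radius {W : Submodule ℝ (Hs n s)}
    (hW : IsClosed (W : Set (Hs n s))) (hWt : ContainsTest O W) (hO : IsBoundedLipschitzDomain O)
    {x₀ : Space n} (hx₀ : x₀ ∈ closure O) :
    ∃ r > 0, ∀ u : Hs n s, (∀ᵐ x, x ∉ O ∩ Metric.ball x₀ r → Hsfn u x = 0) → u ∈ W := by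
  by_cases h : x₀ ∈ O
  · exact exists_radius_of_mem hW hWt hO.isOpen h
  · exact exists_radius_of_mem_frontier hW hWt hO
      (by rw [hO.isOpen.frontier_eq]; exact ⟨hx₀, h⟩)

/-- A finite smooth partition of unity subordinate to balls centred in a compact set. -/
theorem exists_partition {K : Set (Space n)} (hK : IsCompact K) {r : Space n → ℝ}
    (hr : ∀ x ∈ K, 0 < r x) : ∃ (t : Finset (Space n)) (f : Space n → Space n → ℝ),
      (∀ x ∈ t, x ∈ K) ∧ (∀ i ∈ t, ContDiff ℝ ∞ (f i) ∧ HasCompactSupport (f i) ∧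
        (∀ x ∉ Metric.ball i (r i), f i x = 0)) ∧ ∀ x ∈ K, ∑ i ∈ t, f i x = 1 := by
  classical
  obtain ⟨t, htK, ht⟩ := hK.elim_nhds_subcover (fun x => Metric.ball x (r x))
    fun x hx => Metric.ball_mem_nhds x (hr x hx)
  obtain ⟨f, hf⟩ := SmoothPartitionOfUnity.exists_isSubordinate (modelWithCornersSelf ℝ (Space n))
    hK.isClosed (fun i : t => Metric.ball (i : Space n) (r i)) (fun _ => Metric.isOpen_ball)
    (by rwa [iUnion_subtype])
  refine ⟨t, fun i x => if h : i ∈ t then f ⟨i, h⟩ x else 0, htK, fun i hi => ?_, fun x hx => ?_⟩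
  · simp only [hi, dif_pos]
    have hsub : tsupport (f ⟨i, hi⟩) ⊆ Metric.ball i (r i) := hf ⟨i, hi⟩
    refine ⟨(f ⟨i, hi⟩).contMDiff.contDiff, ?_, fun x hx => ?_⟩
    · exact (isCompact_closedBall i (r i)).of_isClosed_subset (isClosed_tsupport _)
        (hsub.trans Metric.ball_subset_closedBall)
    · exact image_eq_zero_of_notMem_tsupport fun h => hx (hsub h)
  · have h := f.sum_eq_one hx
    rw [finsum_eq_sum_of_fintype] at h
    rw [← h, ← Finset.sum_coe_sort t]
    refine Finset.sum_congr rfl fun i _ => ?_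
    simp

theorem Hsfn_sum_ae {ι : Type*} (t : Finset ι) (v : ι → Hs n s) :
    Hsfn (∑ i ∈ t, v i) =ᵐ[volume] fun x => ∑ i ∈ t, Hsfn (v i) x := by
  classical
  induction t using Finset.induction_on with
  | empty =>
    simp only [Finset.sum_empty]
    exact Lp.coeFn_zero ℝ 2 (volume : Measure (Space n))
  | insert i t hi ih =>
    rw [Finset.sum_insert hi]
    filter_upwards [Hsfn_add_ae (v i) (∑ i ∈ t, v i), ih] with x h1 h2
    rw [h1, h2, Finset.sum_insert hi]

/-- In a bounded Lipschitz domain `O`, the test functions are dense in the space of the functions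
in `Hˢ(ℝⁿ)` that vanish outside `O`. -/
theorem HsTilde_le_of_containsTest (hn : 1 ≤ n) (hs0 : 0 < s) (hs1 : s < 1)
    {W : Submodule ℝ (Hs n s)} (hW : IsClosed (W : Set (Hs n s))) (hWt : ContainsTest O W)
    (hO : IsBoundedLipschitzDomain O) : HsTilde s O ≤ W := by
  intro u hu
  have hu : ∀ᵐ x, x ∉ O → Hsfn u x = 0 := hu
  have hcpt : IsCompact (closure O) := hO.isBounded.isCompact_closure
  -- Each point of the compact closure has a ball on which membership in `W` is known; a finite
  -- partition of unity splits `u` into pieces supported in such balls.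
  choose! r hr0 hr using fun x (hx : x ∈ closure O) => exists_radius hW hWt hO hx
  obtain ⟨t, f, htK, hf, hsum⟩ := exists_partition hcpt hr0
  have hex : ∀ i ∈ t, ∃ v : Hs n s, Hsfn v =ᵐ[volume] fun x => f i x * Hsfn u x := by
    intro i hi
    obtain ⟨M, hM⟩ := (hf i hi).2.1.exists_bound_of_continuous (hf i hi).1.continuous
    obtain ⟨L, hL⟩ := (hf i hi).1.lipschitzWith_of_hasCompactSupport (hf i hi).2.1 (by simp)
    exact exists_mul_Hs hn hs0 hs1 hM hL u
  choose! v hv using hex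
  have hvW : ∀ i ∈ t, v i ∈ W := by
    intro i hi
    refine hr i (htK i hi) (v i) ?_
    filter_upwards [hv i hi, hu] with x h1 h2 hx
    rw [h1]
    by_cases hxO : x ∈ O
    · rw [(hf i hi).2.2 x fun h => hx ⟨hxO, h⟩, zero_mul]
    · rw [h2 hxO, mul_zero]
  have e : u = ∑ i ∈ t, v i := by
    refine Hs_ext_ae ?_
    have hv' : ∀ᵐ x, ∀ i ∈ t, Hsfn (v i) x = f i x * Hsfn u x :=
      (Finset.eventually_all t).2 hv
    filter_upwards [Hsfn_sum_ae t v, hv', hu] with x h1 h2 h3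
    rw [h1, Finset.sum_congr rfl h2, ← Finset.sum_mul]
    by_cases hxO : x ∈ O
    · rw [hsum x (subset_closure hxO), one_mul]
    · rw [h3 hxO, mul_zero]
  rw [e]
  exact Submodule.sum_mem _ hvW

end Density

end FracHom


/-! ### Conclusion. -/

theorem theorem1p2 {n : ℕ} (hn : 1 ≤ n) {s : ℝ} (hs0 : 0 < s) (hs1 : s < 1)
    {O : Set (FracHom.Space n)} (hO : FracHom.IsBoundedLipschitzDomain O)
    -- the holes
    (T : ℝ → Set (FracHom.Space n)) (hT : ∀ ε > 0, IsClosed (T ε))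
    (hmeas : Tendsto (fun ε => volume (O \ FracHom.perforated O T ε)) (𝓝[>] 0) (𝓝 0))
    -- functions in H¹(O) that vanish on the holes and converge weakly to 1
    (w : ℝ → FracHom.H1 O)
    (hw_holes : ∀ ε > 0, ∀ᵐ x ∂(volume.restrict O), x ∈ FracHom.holes T ε → FracHom.H1fn (w ε) x = 0)
    (hw_weak : FracHom.WeaklyTendsto w (𝓝[>] 0) (FracHom.H1.one hO.isBounded))
    -- the data and the solutions in the perforated domains
    (f : FracHom.HsTilde s O →L[ℝ] ℝ) (g : FracHom.Hs n s)
    (u : ℝ → FracHom.Hs n s)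
    (hu : ∀ ε > 0, FracHom.IsWeakSolution f g (FracHom.perforated O T ε) (u ε)) :
    ∃ u₀ : FracHom.Hs n s,
      FracHom.IsWeakSolution f g O u₀ ∧
      (∀ v : FracHom.Hs n s, FracHom.IsWeakSolution f g O v → v = u₀) ∧
      ∀ e : ℕ → ℝ, (∀ k, 0 < e k) → Tendsto e atTop (𝓝 0) →
        ∃ φ : ℕ → ℕ, StrictMono φ ∧
          FracHom.WeaklyTendsto (fun k => u (e (φ k))) atTop u₀ := by
  obtain ⟨u₀, hu₀⟩ := FracHom.exists_isWeakSolution hn hs0 hs1 hO.isBounded f g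
  have hle : FracHom.HsTilde s O ≤ FracHom.perforatedClosure s O T :=
    FracHom.HsTilde_le_of_containsTest hn hs0 hs1 (FracHom.isClosed_perforatedClosure O T)
      (fun _ hφ hc hsupp _ hv => FracHom.mem_perforatedClosure_of_test hn hs0 hs1 hO hw_holes
        hw_weak hφ hc hsupp hv) hO
  have hlim := FracHom.tendsto_of_mem_perforatedClosure hn hs0 hs1 hO.isBounded T f g hu₀
    (hle hu₀.1) hu
  refine ⟨u₀, hu₀, fun v hv => hu₀.unique hn hs0 hs1 hO.isBounded hv, fun e he he0 =>
    -- No extraction is needed: the whole sequence converges in norm, hence weakly.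
    ⟨id, strictMono_id, FracHom.weaklyTendsto_of_tendsto (hlim.comp ?_)⟩⟩
  exact tendsto_nhdsWithin_iff.2 ⟨he0, Eventually.of_forall he⟩
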